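/- **Conventions.** Let $S^2\subset\mathbb R^3$ be the unit sphere with surface measure $dS$ (total mass $4\pi$), $\mathbf N=(0,0,1)$, $\mathbf S=(0,0,-1)$, $U_I=S^2\setminus\{\mathbf N,\mathbf S\}$ with spherical coordinates $(\theta,\phi)$, and $\rho_I(p)$ the unit tangent vector at $p\in U_I$ to the circle $\theta=$ const in the direction of increasing $\phi$. For $R\in SO(3)$ let $U_R=RU_I$, with rotated coordinates $(\theta_R,\phi_R)(p)=(\theta,\phi)(R^{-1}p)$, and $\rho_R(Rp)=R_*\rho_I(p)$. For nonzero tangent vectors $v,w$ at $p$, the angle from $v$ to $w$ is the $\psi\in(-\pi,\pi]$ with $\langle v,w\rangle=r\cos\psi$, $\langle v\times p,w\rangle=r\sin\psi$, $r>0$ (so $(\partial/\partial y,\partial/\partial x)$ is oriented at $\mathbf N$). Let $s\in\mathbb Z$. A spin $s$ function is a family $f=(f_R)_{R\in SO(3)}$, $f_R:U_R\to\mathbb C$, with $f_{R_2}(p)=e^{is\psi}f_{R_1}(p)$ on $U_{R_1}\cap U_{R_2}$, $\psi$ the angle from $\rho_{R_1}(p)$ to $\rho_{R_2}(p)$; it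 is in $L^2(\mathbf L^s)$ if the $f_R$ are square integrable, and $\langle f,g\rangle=\int f_R\overline{g_R}\,dS$, which does not depend on $R$. On smooth spin $s$ functions put $$(\partial f)_R=-(\sin\theta_R)^s\Big(\frac{\partial}{\partial\theta_R}+\frac{i}{\sin\theta_R}\frac{\partial}{\partial\phi_R}\Big)\big((\sin\theta_R)^{-s}f_R\big),\qquad \overline\partial f=\overline{\partial\overline f}.$$ Let $l\ge|s|$ be an integer. For $-l\le m\le l$ let $$Y_{lm}=e^{im\phi}(-1)^{m^-}\frac{a_{lm}}{l!}\sin^{2l}(\theta/2)\sum_r\binom lr\binom l{r-m}(-1)^{l-r}\cot^{2r-m}(\theta/2),\quad a_{lm}=\Big[\frac{(l+m)!\,(l-m)!\,(2l+1)}{4\pi}\Big]^{1/2},$$ where $m^-=\max(-m,0)$, extended continuously to the poles; let ${}_sY_{lm}=\big[\frac{(l-s)!}{(l+s)!}\big]^{1/2}\partial^sY_{lm}$ for $s\ge0$ and ${}_sY_{lm}=\big[\frac{(l+s)!}{(l-s)!}\big]^{1/2}(-\overline\partial)^{-s}Y_{lm}$ for $s<0$, where $Y_{lm}$ is viewed as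 a spin $0$ function. Let $\mathcal H_{ls}$ be the complex linear span of the ${}_sY_{lm}$, $-l\le m\le l$, and, with $s^+=\max(s,0)$, $${}_sZ_l=(-1)^{s^+}\sqrt{\frac{2l+1}{4\pi}}\;{}_sY_{l,-s},\qquad K^{ls}_{R',R}(x,y)=\sum_{m=-l}^{l}{}_sY_{lmR'}(x)\,\overline{{}_sY_{lmR}(y)}\quad(x\in U_{R'},\ y\in U_R).$$ **Theorem 5.1.** Let $l\ge|s|$. (0) $\mathcal H_{ls}\subset L^2(\mathbf L^s)$, and $K^{ls}$ is the smooth kernel of the orthogonal projection $P_{ls}$ of $L^2(\mathbf L^s)$ onto $\mathcal H_{ls}$: each $K^{ls}_{R',R}$ is $C^\infty$ on $U_{R'}\times U_R$; one has $K^{ls}_{R_1',R_1}(x,y)=e^{is(\psi_1-\psi_2)}K^{ls}_{R',R}(x,y)$ for $x\in U_{R_1'}\cap U_{R'}$, $y\in U_{R_1}\cap U_R$, where $\psi_1$ is the angle from $\rho_{R'}(x)$ to $\rho_{R_1'}(x)$ and $\psi_2$ the angle from $\rho_R(y)$ to $\rho_{R_1}(y)$; and $(P_{ls}f)_{R'}(x)=\int_{S^2}K^{ls}_{R',R}(x,y)f_R(y)\,dS(y)$,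 with integrable integrand, for all $f\in L^2(\mathbf L^s)$, all $R,R'\in SO(3)$ and $x\in U_{R'}$. (a) If $\mathbf N\in U_R$ and $x\in U_I\cap U_{R'}$, then $${}_sZ_{lI}(x)=e^{is(\psi_1-\psi_2)}K^{ls}_{R',R}(x,\mathbf N),$$ where $\psi_1$ is the angle from $\rho_{R'}(x)$ to $\rho_I(x)$ and $\psi_2$ is the angle from $\rho_R(\mathbf N)$ to $\partial/\partial y$ at $\mathbf N$. (b) For every $f\in\mathcal H_{ls}$, $\displaystyle\lim_{\theta\to0^+}e^{is\phi}f_I(\theta,\phi)=\langle f,{}_sZ_l\rangle$, uniformly in $\phi$. -/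

import Mathlib

open MeasureTheory Filter Topology
open scoped Manifold ContDiff ComplexConjugate Matrix

noncomputable section

namespace SpinSphere

/-! ### The sphere, its rotations, spherical coordinates -/

abbrev E3 : Type := EuclideanSpace ℝ (Fin 3)

/-- The unit sphere of Euclidean space `ℝ³`. -/
abbrev S2 : Type := Metric.sphere (0 : E3) 1

instance : Fact (Module.finrank ℝ E3 = 2 + 1) := ⟨by simp⟩

/-- The rotation group `SO(3)`. -/
abbrev SO3 : Type := Matrix.specialOrthogonalGroup (Fin 3) ℝ

/-- The usual surface measure on the sphere, of total mass `4π`. -/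
abbrev dS : Measure S2 := (volume : Measure E3).toSphere

theorem sum_sq_of_mem (p : S2) : p.1 0 ^ 2 + p.1 1 ^ 2 + p.1 2 ^ 2 = 1 := by
  have h : ‖p.1‖ = 1 := by simp
  have h2 := EuclideanSpace.norm_sq_eq p.1
  rw [h, Fin.sum_univ_three] at h2
  simp only [Real.norm_eq_abs, sq_abs] at h2
  linarith

theorem rotate_mem (R : SO3) (p : S2) :
    WithLp.toLp 2 (R.1 *ᵥ p.1.ofLp) ∈ Metric.sphere (0 : E3) 1 := by
  have hR : R.1ᵀ * R.1 = 1 := by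
    exact (Matrix.mem_orthogonalGroup_iff' _ _).1 (Matrix.mem_specialOrthogonalGroup_iff.1 R.2).1
  have h1 : (R.1 *ᵥ p.1.ofLp) ⬝ᵥ (R.1 *ᵥ p.1.ofLp) = p.1.ofLp ⬝ᵥ p.1.ofLp := by
    rw [Matrix.dotProduct_mulVec, ← Matrix.mulVec_transpose, Matrix.mulVec_mulVec, hR,
      Matrix.one_mulVec]
  have h2 := sum_sq_of_mem p
  simp only [dotProduct, Fin.sum_univ_three] at h1
  rw [mem_sphere_zero_iff_norm, EuclideanSpace.norm_eq, Fin.sum_univ_three]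
  simp only [Real.norm_eq_abs, sq_abs]
  rw [Real.sqrt_eq_one]
  nlinarith [h1, h2]

/-- The action of a rotation on the sphere. -/
def rot (R : SO3) (p : S2) : S2 := ⟨WithLp.toLp 2 (R.1 *ᵥ p.1.ofLp), rotate_mem R p⟩

theorem sph_mem (θ φ : ℝ) :
    !₂[Real.sin θ * Real.cos φ, Real.sin θ * Real.sin φ, Real.cos θ] ∈
      Metric.sphere (0 : E3) 1 := by
  rw [mem_sphere_zero_iff_norm, EuclideanSpace.norm_eq, Fin.sum_univ_three]
  simp only [Real.norm_eq_abs, sq_abs]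
  rw [Real.sqrt_eq_one]
  simp
  nlinarith [Real.sin_sq_add_cos_sq θ, Real.sin_sq_add_cos_sq φ]

/-- The point with spherical coordinates `(θ, φ)`. -/
def sph (θ φ : ℝ) : S2 :=
  ⟨!₂[Real.sin θ * Real.cos φ, Real.sin θ * Real.sin φ, Real.cos θ], sph_mem θ φ⟩

/-- The polar angle `θ ∈ [0, π]`. -/
def polar (p : S2) : ℝ := Real.arccos (p.1 2)

/-- The azimuth `φ ∈ (-π, π]` (with value `0` at the two poles). -/
def azimuth (p : S2) : ℝ := Complex.arg ⟨p.1 0, p.1 1⟩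

/-- The north pole `(0, 0, 1)`. -/
def north : S2 := ⟨!₂[0, 0, 1], by
  rw [mem_sphere_zero_iff_norm, EuclideanSpace.norm_eq, Fin.sum_univ_three]; simp⟩

/-- The south pole `(0, 0, -1)`. -/
def south : S2 := ⟨!₂[0, 0, -1], by
  rw [mem_sphere_zero_iff_norm, EuclideanSpace.norm_eq, Fin.sum_univ_three]; simp⟩

/-- The chart domain `U_R = R U_I`, where `U_I` is the sphere without its two poles. -/
def chart (R : SO3) : Set S2 := rot R '' {north, south}ᶜ

/-! ### Reference directions and angles -/

/-- `ρ_I(p)`: the unit tangent vector at `p` to the circle `θ = const`, in the direction of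
increasing `φ` (meaningful away from the poles). -/
def refI (p : S2) : Fin 3 → ℝ := ![-Real.sin (azimuth p), Real.cos (azimuth p), 0]

/-- `ρ_R(p) = R_* ρ_I(R⁻¹ p)`, the reference direction on `U_R`. -/
def ref (R : SO3) (p : S2) : Fin 3 → ℝ := R.1 *ᵥ refI (rot R⁻¹ p)

/-- The angle in `(-π, π]` from `v` to `w`, nonzero tangent vectors at `p`.  The sphere carries the
orientation for which `(∂/∂x, ∂/∂y)` is oriented at the south pole and `(∂/∂y, ∂/∂x)` at the north
pole, so `v` followed by `J v = v × p` is an oriented orthogonal basis at `p`; the angle `ψ` has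
`⟨v, w⟩ = r cos ψ` and `⟨J v, w⟩ = r sin ψ` with `r > 0`. -/
def angle (p : S2) (v w : Fin 3 → ℝ) : ℝ :=
  Complex.arg ⟨v ⬝ᵥ w, (v ⨯₃ p.1.ofLp) ⬝ᵥ w⟩

/-! ### Spin functions -/

/-- A family `(f_R)` of functions indexed by `R ∈ SO(3)`; only the values of `f_R` on `U_R` matter.
Sections of the spin `s` line bundle are the families that obey the transition law `IsSpin s`. -/
abbrev Family : Type := SO3 → S2 → ℂ

/-- The transition law `f_{R₂}(p) = e^{isψ} f_{R₁}(p)` on `U_{R₁} ∩ U_{R₂}`, where `ψ` is the angle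
from `ρ_{R₁}(p)` to `ρ_{R₂}(p)`. -/
def IsSpin (s : ℤ) (f : Family) : Prop :=
  ∀ R₁ R₂ : SO3, ∀ p ∈ chart R₁ ∩ chart R₂,
    f R₂ p = Complex.exp (Complex.I * s * angle p (ref R₁ p) (ref R₂ p)) * f R₁ p

/-- The square-integrable spin `s` functions `L²(Lˢ)`. -/
def spinL2 (s : ℤ) : Submodule ℂ Family where
  carrier := {f | IsSpin s f ∧ ∀ R, MemLp (f R) 2 dS}
  zero_mem' := ⟨fun R₁ R₂ p _ => by simp, fun R => MemLp.zero⟩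
  add_mem' := by
    rintro f g ⟨hf, hf'⟩ ⟨hg, hg'⟩
    refine ⟨fun R₁ R₂ p hp => ?_, fun R => (hf' R).add (hg' R)⟩
    simp only [Pi.add_apply]
    rw [hf R₁ R₂ p hp, hg R₁ R₂ p hp, mul_add]
  smul_mem' := by
    rintro c f ⟨hf, hf'⟩
    refine ⟨fun R₁ R₂ p hp => ?_, fun R => (hf' R).const_smul c⟩
    simp only [Pi.smul_apply, smul_eq_mul]
    rw [hf R₁ R₂ p hp]
    ring

/-- The inner product `⟨f, g⟩ = ∫ f_R \overline{g_R} dS`, computed with `R = I` (on spin functions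
of equal spin the integrand does not depend on `R`).  It is linear in the first variable. -/
def spinInner (f g : Family) : ℂ := ∫ p : S2, f 1 p * conj (g 1 p) ∂(dS)

/-! ### Spin-raising and spin-lowering operators -/

/-- `∂_{sI} h = -(sin θ)^s (∂/∂θ + (i / sin θ) ∂/∂φ) ((sin θ)^{-s} h)`. -/
def edthI (s : ℤ) (h : S2 → ℂ) (p : S2) : ℂ :=
  let θ := polar p;
  let φ := azimuth p;
  let u : ℝ → ℝ → ℂ := fun a b => ((Real.sin a ^ (-s) : ℝ) : ℂ) * h (sph a b);
  -((Real.sin θ ^ s : ℝ) : ℂ) *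
    (deriv (fun a => u a φ) θ + Complex.I / (Real.sin θ : ℂ) * deriv (fun b => u θ b) φ)

/-- `(∂ f)_R = [∂_{sI} (f_R ∘ R)] ∘ R⁻¹`: the same formula in the coordinates rotated by `R`. -/
def edth (s : ℤ) (f : Family) : Family :=
  fun R p => edthI s (fun q => f R (rot R q)) (rot R⁻¹ p)

/-- Complex conjugation, from spin `s` to spin `-s`. -/
def conjF (f : Family) : Family := fun R p => conj (f R p)

/-- The spin-lowering operator on spin `s` functions, the conjugate of `∂` applied to `f̄`. -/
def edthBar (s : ℤ) (f : Family) : Family := conjF (edth (-s) (conjF f))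

/-- `∂^k` from spin `0` to spin `k`. -/
def edthPow : ℕ → Family → Family
  | 0, f => f
  | k + 1, f => edth (k : ℤ) (edthPow k f)

/-- `(-∂̄)^k` from spin `0` to spin `-k`. -/
def negEdthBarPow : ℕ → Family → Family
  | 0, f => f
  | k + 1, f => -edthBar (-(k : ℤ)) (negEdthBarPow k f)

/-! ### Spherical harmonics -/

/-- The binomial coefficient `n` over `j`, with value zero for `j < 0`. -/
def binom (n : ℕ) (j : ℤ) : ℝ := if 0 ≤ j then (n.choose j.toNat : ℝ) else 0

/-- The factorial of an integer that is known to be nonnegative. -/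
def zfact (n : ℤ) : ℝ := (n.toNat.factorial : ℝ)

/-- `a_{lm} = [(l+m)! (l-m)! (2l+1) / 4π]^{1/2}`. -/
def aCoeff (l : ℕ) (m : ℤ) : ℝ :=
  Real.sqrt (zfact (l + m) * zfact (l - m) * (2 * l + 1) / (4 * Real.pi))

/-- The standard spherical harmonic
`Y_{lm} = e^{imφ} (-1)^{m⁻} (a_{lm} / l!) sin^{2l}(θ/2) ∑_r C(l,r) C(l,r-m) (-1)^{l-r} cot^{2r-m}(θ/2)`
for `-l ≤ m ≤ l`.  The factors `sin^{2l} cot^{2r-m}` are written `sin^{2l-2r+m} cos^{2r-m}`: both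
exponents are nonnegative in every nonzero term, so that the formula holds at the poles too. -/
def Y (l : ℕ) (m : ℤ) (p : S2) : ℂ :=
  Complex.exp (Complex.I * m * azimuth p) *
    (((-1) ^ (-m).toNat * (aCoeff l m / (l.factorial : ℝ)) *
      ∑ r ∈ Finset.range (l + 1),
        (l.choose r : ℝ) * binom l ((r : ℤ) - m) * (-1) ^ (l - r) *
          Real.sin (polar p / 2) ^ (2 * (l : ℤ) - 2 * r + m).toNat *
          Real.cos (polar p / 2) ^ (2 * (r : ℤ) - m).toNat : ℝ) : ℂ)

/-- The spin `s` spherical harmonic `_sY_{lm}` (for `|s| ≤ l`, `-l ≤ m ≤ l`). -/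
def sY (l : ℕ) (s m : ℤ) : Family :=
  if 0 ≤ s then
    ((Real.sqrt (zfact (l - s) / zfact (l + s)) : ℝ) : ℂ) •
      edthPow s.toNat (fun _ => Y l m)
  else
    ((Real.sqrt (zfact (l + s) / zfact (l - s)) : ℝ) : ℂ) •
      negEdthBarPow (-s).toNat (fun _ => Y l m)

/-- `H_{ls}`, the linear span of `_sY_{lm}`, `-l ≤ m ≤ l`. -/
def H (l : ℕ) (s : ℤ) : Submodule ℂ Family :=
  Submodule.span ℂ {f | ∃ m : ℤ, -(l : ℤ) ≤ m ∧ m ≤ l ∧ f = sY l s m}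

/-- The spin zonal harmonic `_sZ_l = (-1)^{s⁺} √((2l+1)/4π) _sY_{l,-s}`. -/
def sZ (l : ℕ) (s : ℤ) : Family :=
  (((-1) ^ s.toNat * Real.sqrt ((2 * l + 1) / (4 * Real.pi)) : ℝ) : ℂ) • sY l s (-s)

/-! ### The projection kernel -/

/-- `K^{ls}_{R',R}(x,y) = ∑_m _sY_{lmR'}(x) \overline{_sY_{lmR}(y)}`. -/
def Kls (l : ℕ) (s : ℤ) (R' R : SO3) (x y : S2) : ℂ :=
  ∑ m ∈ Finset.Icc (-(l : ℤ)) l, sY l s m R' x * conj (sY l s m R y)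

/-- `K` is the smooth kernel, read in the trivializations over the charts `U_{R'}` and `U_R`, of
the orthogonal projection of `L²(Lˢ)` onto its subspace `V`. -/
structure IsProjectionKernel (s : ℤ) (V : Submodule ℂ Family)
    (K : SO3 → SO3 → S2 → S2 → ℂ) : Prop where
  le_spinL2 : V ≤ spinL2 s
  smooth : ∀ R' R : SO3, ContMDiffOn ((𝓡 2).prod (𝓡 2)) 𝓘(ℝ, ℂ) ∞
    (fun z : S2 × S2 => K R' R z.1 z.2) (chart R' ×ˢ chart R)
  transition : ∀ R' R R₁' R₁ : SO3, ∀ x ∈ chart R₁' ∩ chart R', ∀ y ∈ chart R₁ ∩ chart R,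
    K R₁' R₁ x y =
      Complex.exp (Complex.I * s *
        (angle x (ref R' x) (ref R₁' x) - angle y (ref R y) (ref R₁ y))) * K R' R x y
  projection : ∀ f ∈ spinL2 s, ∃ h ∈ V, (∀ g ∈ V, spinInner (f - h) g = 0) ∧
    ∀ R' R : SO3, ∀ x ∈ chart R',
      Integrable (fun y => K R' R x y * f R y) dS ∧ h R' x = ∫ y, K R' R x y * f R y ∂dS

end SpinSphere

end

noncomputable section

namespace SpinSphere

/-! ### Rotations and charts -/

/-! All harmonics of degree `l` and spin `s` are packed into one polynomial in an auxiliary variable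
`z`. Pairing a vector with the null vector `nullVec z` gives a quadratic polynomial `nullPoly`. Let
`t = ρ × p + iρ` (`tang`) be the null tangent vector of the frame at `p`. Then `spinPoly` is
`nullPoly p ^ (l - |s|)` times the `|s|`-th power of `nullPoly (-t)` or `nullPoly (conj t)`,
according to the sign of `s`. Its coefficient of `z ^ (l + m)` is, up to a real constant, the
harmonic `_sY_{lm}` (`sY_eq_coeff`).

For `s = 0` this is the binomial formula for `Y_{lm}`. Higher spin follows because `∂` turns a
factor `β · p` into `-β · t` and annihilates the factors `β · t` already present (`edthI_sum_pow`).
The case `s < 0` follows by conjugation. A change of frame multiplies `t` by `e^{iψ}`, whence the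
spin transition law (`tang_eq_smul`, `spinPoly_transition`). In spherical coordinates, with `w =
e^{iφ} z`, `c = cos (θ/2)` and `σ = sin (θ/2)`, the polynomial is `e^{-ilφ} (c w - σ)^{l-s} (σ w +
c)^{l+s}` (`spinPoly_sph`).

Orthonormality comes from symmetry. A rotation acts on `spinPoly` by a Möbius substitution in `z`
and preserves `dS`; this forces the Gram matrix of the coefficients to be diagonal with entries
proportional to `(2l choose i)` (`gram_eq`). The constant is found by integrating a pointwise
identity for the squared coefficients (`gram_zero_zero`). The kernel of the projection is then the
usual sum over an orthonormal basis.

At the north pole, in the frame `∂/∂y`, the polynomial reduces to `z ^ (l - s)`. Hence only `m = -s`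
survives there, which gives both the zonal formula (`sZ_eq_Kls_north`) and the limit at the pole
(`tendsto_north`). -/

theorem transpose_mul_self (R : SO3) : R.1ᵀ * R.1 = 1 :=
  (Matrix.mem_orthogonalGroup_iff' _ _).1 (Matrix.mem_specialOrthogonalGroup_iff.1 R.2).1

theorem det_eq_one (R : SO3) : R.1.det = 1 := (Matrix.mem_specialOrthogonalGroup_iff.1 R.2).2

theorem rot_one (p : S2) : rot 1 p = p := by
  ext i; simp [rot]

theorem rot_mul (Q R : SO3) (p : S2) : rot (Q * R) p = rot Q (rot R p) := by
  ext i; simp [rot, Matrix.mulVec_mulVec]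

theorem rot_inv_rot (R : SO3) (p : S2) : rot R⁻¹ (rot R p) = p := by
  rw [← rot_mul, inv_mul_cancel, rot_one]

theorem rot_rot_inv (R : SO3) (p : S2) : rot R (rot R⁻¹ p) = p := by
  rw [← rot_mul, mul_inv_cancel, rot_one]

theorem mem_chart_iff {R : SO3} {p : S2} :
    p ∈ chart R ↔ rot R⁻¹ p ∈ ({north, south}ᶜ : Set S2) := by
  constructor
  · rintro ⟨q, hq, rfl⟩
    rwa [rot_inv_rot]
  · intro h
    exact ⟨_, h, rot_rot_inv R p⟩

theorem rot_mem_chart {R : SO3} {q : S2} (hq : q ∈ ({north, south}ᶜ : Set S2)) :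
    rot R q ∈ chart R := ⟨q, hq, rfl⟩

theorem mem_chart_one {p : S2} : p ∈ chart 1 ↔ p ∈ ({north, south}ᶜ : Set S2) := by
  rw [mem_chart_iff, inv_one, rot_one]

theorem continuous_rot (R : SO3) : Continuous (rot R) := by
  unfold rot
  fun_prop

/-! ### Spherical coordinates -/

theorem dot_self (p : S2) : p.1.ofLp ⬝ᵥ p.1.ofLp = 1 := by
  have := sum_sq_of_mem p
  simp only [dotProduct, Fin.sum_univ_three]
  linarith

theorem polar_mem {p : S2} (hp : p ∈ ({north, south}ᶜ : Set S2)) :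
    polar p ∈ Set.Ioo 0 Real.pi := by
  have h := sum_sq_of_mem p
  have h1 : p.1 2 ^ 2 ≠ 1 := by
    intro h1
    have h0 : p.1 0 = 0 := by nlinarith [sq_nonneg (p.1 0), sq_nonneg (p.1 1)]
    have h0' : p.1 1 = 0 := by nlinarith [sq_nonneg (p.1 0), sq_nonneg (p.1 1)]
    apply hp
    rcases (sq_eq_sq_iff_eq_or_eq_neg.1 (h1.trans (one_pow 2).symm)) with h2 | h2
    · left
      ext i; fin_cases i <;> simp [north, h0, h0', h2]
    · right
      ext i; fin_cases i <;> simp [south, h0, h0', h2]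
  have h2 : p.1 2 ^ 2 < 1 := lt_of_le_of_ne (by nlinarith [sq_nonneg (p.1 0), sq_nonneg (p.1 1)]) h1
  have h3 := abs_lt.1 ((sq_lt_one_iff_abs_lt_one _).1 h2)
  refine ⟨Real.arccos_pos.2 h3.2, ?_⟩
  refine lt_of_le_of_ne (Real.arccos_le_pi _) fun h4 => ?_
  have := Real.arccos_eq_pi.1 h4
  linarith

theorem sph_polar_azimuth (p : S2) : sph (polar p) (azimuth p) = p := by
  have h := sum_sq_of_mem p
  have hs : Real.sin (polar p) = ‖(⟨p.1 0, p.1 1⟩ : ℂ)‖ := by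
    rw [polar, Real.sin_arccos, Complex.norm_eq_sqrt_sq_add_sq]
    congr 1
    simp only
    linarith
  have hc : Real.cos (polar p) = p.1 2 := by
    rw [polar, Real.cos_arccos] <;> nlinarith [sq_nonneg (p.1 0), sq_nonneg (p.1 1)]
  ext i
  fin_cases i
  · simp [sph, hs, azimuth]
  · simp [sph, hs, azimuth]
  · simpa [sph] using hc

theorem apply_zero_eq (p : S2) : p.1 0 = Real.sin (polar p) * Real.cos (azimuth p) := by
  conv_lhs => rw [← sph_polar_azimuth p]
  rfl

theorem apply_one_eq (p : S2) : p.1 1 = Real.sin (polar p) * Real.sin (azimuth p) := by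
  conv_lhs => rw [← sph_polar_azimuth p]
  rfl

theorem sph_mem_compl {a : ℝ} (b : ℝ) (ha : Real.sin a ≠ 0) :
    sph a b ∈ ({north, south}ᶜ : Set S2) := by
  have key : ∀ q : S2, q.1 0 = 0 → q.1 1 = 0 → sph a b ≠ q := by
    rintro q h0 h1 rfl
    simp [sph, ha] at h0 h1
    have := Real.sin_sq_add_cos_sq b
    simp [h0, h1] at this
  rintro (h | h)
  · exact key _ (by simp [north]) (by simp [north]) h
  · exact key _ (by simp [south]) (by simp [south]) h

theorem refI_eq {p : S2} (hp : p ∈ ({north, south}ᶜ : Set S2)) :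
    refI p = (Real.sqrt (p.1 0 ^ 2 + p.1 1 ^ 2))⁻¹ • ![-p.1 1, p.1 0, 0] := by
  have h1 := polar_mem hp
  have h2 := Real.sin_pos_of_mem_Ioo h1
  have h3 : Real.sqrt (p.1 0 ^ 2 + p.1 1 ^ 2) = Real.sin (polar p) := by
    have h := sum_sq_of_mem p
    rw [polar, Real.sin_arccos]
    congr 1
    linarith
  rw [h3, apply_zero_eq, apply_one_eq]
  ext i
  fin_cases i <;> simp [refI, h2.ne']

theorem refI_sph {a : ℝ} (b : ℝ) (ha : 0 < Real.sin a) :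
    refI (sph a b) = ![-Real.sin b, Real.cos b, 0] := by
  rw [refI_eq (sph_mem_compl b ha.ne')]
  have h3 : Real.sqrt ((sph a b).1 0 ^ 2 + (sph a b).1 1 ^ 2) = Real.sin a := by
    rw [Real.sqrt_eq_iff_mul_self_eq (by positivity) ha.le]
    simp only [sph]
    simp
    nlinarith [Real.sin_sq_add_cos_sq b]
  rw [h3]
  ext i
  fin_cases i <;> simp [sph, ha.ne']

theorem refI_dot_self (p : S2) : refI p ⬝ᵥ refI p = 1 := by
  simp [refI, dotProduct, Fin.sum_univ_three]
  nlinarith [Real.sin_sq_add_cos_sq (azimuth p)]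

theorem refI_dot (p : S2) : refI p ⬝ᵥ p.1.ofLp = 0 := by
  simp [refI, dotProduct, Fin.sum_univ_three, apply_zero_eq, apply_one_eq]
  ring

/-! ### Moving frames -/

theorem mulVec_dot_mulVec (R : SO3) (v w : Fin 3 → ℝ) : (R.1 *ᵥ v) ⬝ᵥ (R.1 *ᵥ w) = v ⬝ᵥ w := by
  rw [Matrix.dotProduct_mulVec, ← Matrix.mulVec_transpose, Matrix.mulVec_mulVec,
    transpose_mul_self, Matrix.one_mulVec]

/-- A matrix in `SO(3)` equals its own cofactor matrix, because its adjugate is its inverse and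
hence its transpose. -/
theorem cross_mulVec (R : SO3) (v w : Fin 3 → ℝ) :
    (R.1 *ᵥ v) ⨯₃ (R.1 *ᵥ w) = R.1 *ᵥ (v ⨯₃ w) := by
  have h : R.1.adjugate = R.1ᵀ := by
    have h1 := Matrix.mul_adjugate R.1
    rw [det_eq_one, one_smul] at h1
    calc R.1.adjugate = R.1ᵀ * R.1 * R.1.adjugate := by rw [transpose_mul_self, one_mul]
      _ = R.1ᵀ := by rw [mul_assoc, h1, mul_one]
  rw [Matrix.adjugate_fin_three] at h
  have e : ∀ i j, R.1 i j = R.1ᵀ j i := fun _ _ => rfl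
  rw [← h] at e
  ext i
  have e0 := e i 0
  have e1 := e i 1
  have e2 := e i 2
  fin_cases i <;>
  · simp [Matrix.mulVec, dotProduct, Fin.sum_univ_three, cross_apply] at e0 e1 e2 ⊢
    rw [e0, e1, e2]
    ring

theorem ref_dot_self (R : SO3) (p : S2) : ref R p ⬝ᵥ ref R p = 1 := by
  rw [ref, mulVec_dot_mulVec, refI_dot_self]

theorem rot_ofLp (R : SO3) (p : S2) : (rot R p).1.ofLp = R.1 *ᵥ p.1.ofLp := rfl

theorem ref_dot (R : SO3) (p : S2) : ref R p ⬝ᵥ p.1.ofLp = 0 := by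
  conv_lhs => rw [← rot_rot_inv R p]
  rw [rot_ofLp, ref, mulVec_dot_mulVec, rot_rot_inv, refI_dot]

theorem ref_mul (Q R : SO3) (p : S2) : ref (Q * R) (rot Q p) = Q.1 *ᵥ ref R p := by
  rw [ref, mul_inv_rev, rot_mul, rot_inv_rot, ref, Matrix.mulVec_mulVec]
  rfl

theorem eq_sum_frame {u p : Fin 3 → ℝ} (hu : u ⬝ᵥ u = 1) (hp : p ⬝ᵥ p = 1) (hup : u ⬝ᵥ p = 0)
    (v : Fin 3 → ℝ) :
    v = (u ⬝ᵥ v) • u + ((u ⨯₃ p) ⬝ᵥ v) • (u ⨯₃ p) + (p ⬝ᵥ v) • p := by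
  let M : Matrix (Fin 3) (Fin 3) ℝ := ![u, u ⨯₃ p, p]
  have h1 : M * Mᵀ = 1 := by
    have c1 : (u ⨯₃ p) ⬝ᵥ u = 0 := by rw [dotProduct_comm]; exact dot_self_cross u p
    have c2 : (u ⨯₃ p) ⬝ᵥ p = 0 := by rw [dotProduct_comm]; exact dot_cross_self u p
    have c3 : (u ⨯₃ p) ⬝ᵥ (u ⨯₃ p) = 1 := by
      rw [cross_dot_cross, hu, hp, hup, dotProduct_comm p u, hup]; simp
    ext i j
    rw [Matrix.mul_apply_eq_vecMul]
    change M i ⬝ᵥ M j = _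
    fin_cases i <;> fin_cases j <;>
      simp [M, hu, hp, hup, c1, c2, c3, dot_self_cross, dot_cross_self, dotProduct_comm p u]
  have h2 : Mᵀ * M = 1 := mul_eq_one_comm.1 h1
  have h3 : v = Mᵀ *ᵥ (M *ᵥ v) := by rw [Matrix.mulVec_mulVec, h2, Matrix.one_mulVec]
  conv_lhs => rw [h3]
  ext i
  simp only [Matrix.mulVec, dotProduct, Fin.sum_univ_three, Pi.add_apply, Pi.smul_apply,
    smul_eq_mul]
  change u i * (u 0 * v 0 + u 1 * v 1 + u 2 * v 2) + (u ⨯₃ p) i * ((u ⨯₃ p) 0 * v 0 +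
    (u ⨯₃ p) 1 * v 1 + (u ⨯₃ p) 2 * v 2) + p i * (p 0 * v 0 + p 1 * v 1 + p 2 * v 2) = _
  ring

/-- The null vector `ρ × p + i ρ` of the frame at `p` with reference direction `ρ = ρ_R(p)`. -/
def tang (R : SO3) (p : S2) : Fin 3 → ℂ :=
  fun i => ((ref R p ⨯₃ p.1.ofLp) i : ℂ) + Complex.I * (ref R p i : ℂ)

theorem exp_angle (R₁ R₂ : SO3) (p : S2) :
    Complex.exp (Complex.I * (angle p (ref R₁ p) (ref R₂ p) : ℝ)) =
      ⟨ref R₁ p ⬝ᵥ ref R₂ p, (ref R₁ p ⨯₃ p.1.ofLp) ⬝ᵥ ref R₂ p⟩ := by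
  set w : ℂ := ⟨ref R₁ p ⬝ᵥ ref R₂ p, (ref R₁ p ⨯₃ p.1.ofLp) ⬝ᵥ ref R₂ p⟩ with hw
  have h := eq_sum_frame (ref_dot_self R₁ p) (dot_self p) (ref_dot R₁ p) (ref R₂ p)
  -- Parseval in the frame of `R₁`: `ρ_{R₂}` is a unit vector with no component along `p`. Without
  -- unit modulus, `exp` of the argument would not recover `w`.
  have h1 : ‖w‖ = 1 := by
    rw [Complex.norm_eq_sqrt_sq_add_sq, Real.sqrt_eq_one]
    have h2 := congrArg (fun v => ref R₂ p ⬝ᵥ v) h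
    simp only [dotProduct_add, dotProduct_smul, ref_dot_self, ref_dot, smul_eq_mul] at h2
    rw [dotProduct_comm (ref R₂ p) (ref R₁ p),
      dotProduct_comm (ref R₂ p) (ref R₁ p ⨯₃ p.1.ofLp)] at h2
    simp only [hw]
    linarith
  have h3 := Complex.norm_mul_exp_arg_mul_I w
  rw [h1, Complex.ofReal_one, one_mul] at h3
  rw [mul_comm, angle]
  exact h3

/-- Write `J v = v × p`. If `ρ' = c ρ + d Jρ`, then `Jρ' = c Jρ - d ρ`, so `Jρ' + iρ' = (c + id)(Jρ
+ iρ)`. This is the source of every spin phase. -/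
theorem tang_eq_smul (R₁ R₂ : SO3) (p : S2) :
    tang R₂ p =
      Complex.exp (Complex.I * (angle p (ref R₁ p) (ref R₂ p) : ℝ)) • tang R₁ p := by
  rw [exp_angle]
  have h := eq_sum_frame (ref_dot_self R₁ p) (dot_self p) (ref_dot R₁ p) (ref R₂ p)
  rw [dotProduct_comm p.1.ofLp, ref_dot, zero_smul, add_zero] at h
  set c := ref R₁ p ⬝ᵥ ref R₂ p
  set d := (ref R₁ p ⨯₃ p.1.ofLp) ⬝ᵥ ref R₂ p
  have hJ : ref R₂ p ⨯₃ p.1.ofLp = c • (ref R₁ p ⨯₃ p.1.ofLp) - d • ref R₁ p := by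
    rw [h, map_add, map_smul, map_smul, LinearMap.add_apply, LinearMap.smul_apply,
      LinearMap.smul_apply, cross_cross_eq_smul_sub_smul, ref_dot, dot_self]
    simp [sub_eq_add_neg]
  ext i
  have hi := congrFun h i
  have hJi := congrFun hJ i
  simp only [Pi.add_apply, Pi.sub_apply, Pi.smul_apply, smul_eq_mul] at hi hJi
  simp only [tang, Pi.smul_apply, smul_eq_mul, hi, hJi]
  apply Complex.ext <;> simp

theorem tang_mul (Q R : SO3) (p : S2) :
    tang (Q * R) (rot Q p) = Q.1.map (algebraMap ℝ ℂ) *ᵥ tang R p := by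
  ext i
  simp only [tang, ref_mul, rot_ofLp, cross_mulVec]
  simp [Matrix.mulVec, dotProduct, Fin.sum_univ_three, tang]
  ring

/-! ### The operators `∂` and `∂̄` on powers of linear forms -/

/-- The point `p` as a complex vector. -/
def cvec (p : S2) : Fin 3 → ℂ := fun i => (p.1 i : ℂ)

/-- A rotation as a complex matrix. -/
abbrev cmat (R : SO3) : Matrix (Fin 3) (Fin 3) ℂ := R.1.map (algebraMap ℝ ℂ)

theorem cvec_rot (R : SO3) (p : S2) : cvec (rot R p) = cmat R *ᵥ cvec p := by
  ext i
  simp [cvec, rot_ofLp, Matrix.mulVec, dotProduct, Fin.sum_univ_three]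

theorem tang_rot (R : SO3) (p : S2) : tang R (rot R p) = cmat R *ᵥ tang 1 p := by
  have := tang_mul R 1 p
  rwa [mul_one] at this

theorem tang_one_sph {a : ℝ} (b : ℝ) (ha : 0 < Real.sin a) :
    tang 1 (sph a b) = ![(Real.cos a : ℂ) * Real.cos b - Complex.I * Real.sin b,
      (Real.cos a : ℂ) * Real.sin b + Complex.I * Real.cos b, -(Real.sin a : ℂ)] := by
  have hr : ref 1 (sph a b) = ![-Real.sin b, Real.cos b, 0] := by
    rw [ref, inv_one, rot_one, refI_sph b ha]
    simp
  have h1 : (Real.cos b : ℂ) ^ 2 = 1 - (Real.sin b : ℂ) ^ 2 := by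
    have := Real.cos_sq' b
    exact_mod_cast this
  ext i
  simp only [tang, hr, cross_apply]
  simp only [sph]
  fin_cases i
  · simp
    ring
  · simp
    ring
  · simp at h1 ⊢
    linear_combination (-Complex.sin a) * h1

theorem cvec_sph (a b : ℝ) : cvec (sph a b) =
    ![(Real.sin a : ℂ) * Real.cos b, (Real.sin a : ℂ) * Real.sin b, (Real.cos a : ℂ)] := by
  ext i
  fin_cases i <;> simp [cvec, sph]

/-- The operator `D = ∂_θ + (i / sin θ) ∂_φ` satisfies `D p = t` and `D (t / sin θ) = 0`, where `t`
is the null tangent vector. The weight `(sin θ)^{-k}` turns `(β · t)^k` into a power of `β · t / sin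
θ`, which `D` treats as a constant, so only the powers of `β · p` are differentiated. The vectors `β
j` are arbitrary. -/
theorem edthI_sum_pow {J : Type*} (S : Finset J) (c : J → ℂ) (β : J → Fin 3 → ℂ) (n k : ℕ)
    {h : S2 → ℂ}
    (hh : ∀ q ∈ ({north, south}ᶜ : Set S2),
      h q = ∑ j ∈ S, c j * (β j ⬝ᵥ cvec q) ^ n * (β j ⬝ᵥ tang 1 q) ^ k)
    {p : S2} (hp : p ∈ ({north, south}ᶜ : Set S2)) :
    edthI k h p =
      -∑ j ∈ S, c j * n * (β j ⬝ᵥ cvec p) ^ (n - 1) * (β j ⬝ᵥ tang 1 p) ^ (k + 1) := by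
  have hs : 0 < Real.sin (polar p) := Real.sin_pos_of_mem_Ioo (polar_mem hp)
  have hpe := sph_polar_azimuth p
  simp only [edthI]
  set θ := polar p
  set φ := azimuth p
  set X : J → ℝ → ℝ → ℂ := fun j a b =>
    β j 0 * ((Real.sin a : ℂ) * Real.cos b) + β j 1 * ((Real.sin a : ℂ) * Real.sin b) +
      β j 2 * Real.cos a with hX
  set E : J → ℝ → ℝ → ℂ := fun j a b =>
    β j 0 * ((Real.cos a : ℂ) * Real.cos b - Complex.I * Real.sin b) +
      β j 1 * ((Real.cos a : ℂ) * Real.sin b + Complex.I * Real.cos b) -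
      β j 2 * Real.sin a with hE
  set W : J → ℝ → ℝ → ℂ := fun j a b => E j a b / Real.sin a with hW
  have hXe : ∀ j a b, β j ⬝ᵥ cvec (sph a b) = X j a b := fun j a b => by
    rw [cvec_sph]; simp [hX, dotProduct, Fin.sum_univ_three]
  have hEe : ∀ j a b, 0 < Real.sin a → β j ⬝ᵥ tang 1 (sph a b) = E j a b := fun j a b ha => by
    rw [tang_one_sph b ha]; simp [hE, dotProduct, Fin.sum_univ_three]; ring
  have hu : ∀ a b, 0 < Real.sin a → ((Real.sin a ^ (-(k : ℤ)) : ℝ) : ℂ) * h (sph a b) =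
      ∑ j ∈ S, c j * (X j a b ^ n * W j a b ^ k) := by
    intro a b ha
    rw [hh _ (sph_mem_compl b ha.ne'), Finset.mul_sum]
    refine Finset.sum_congr rfl fun j _ => ?_
    rw [hXe, hEe j a b ha, hW]
    simp only [div_pow, zpow_neg, zpow_natCast, Complex.ofReal_inv, Complex.ofReal_pow]
    ring
  have hsC : (Real.sin θ : ℂ) ≠ 0 := by exact_mod_cast hs.ne'
  have dsin : ∀ a : ℝ, HasDerivAt (fun a : ℝ => (Real.sin a : ℂ)) (Real.cos a : ℂ) a :=
    fun a => (Real.hasDerivAt_sin a).ofReal_comp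
  have dcos : ∀ a : ℝ, HasDerivAt (fun a : ℝ => (Real.cos a : ℂ)) (-(Real.sin a : ℂ)) a :=
    fun a => by simpa using (Real.hasDerivAt_cos a).ofReal_comp
  set Xa : J → ℂ := fun j => β j 0 * ((Real.cos θ : ℂ) * Real.cos φ) +
    β j 1 * ((Real.cos θ : ℂ) * Real.sin φ) - β j 2 * Real.sin θ with hXa
  set Xb : J → ℂ := fun j => Real.sin θ * (-β j 0 * Real.sin φ + β j 1 * Real.cos φ) with hXb
  set Eb : J → ℂ := fun j => β j 0 * (-(Real.cos θ : ℂ) * Real.sin φ - Complex.I * Real.cos φ) +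
    β j 1 * ((Real.cos θ : ℂ) * Real.cos φ - Complex.I * Real.sin φ) with hEb
  set Wa : J → ℂ := fun j =>
    (-X j θ φ * Real.sin θ - E j θ φ * Real.cos θ) / (Real.sin θ : ℂ) ^ 2 with hWa
  have dXa : ∀ j, HasDerivAt (fun a => X j a φ) (Xa j) θ := fun j => by
    refine (((((dsin θ).mul_const _).const_mul _).add
      (((dsin θ).mul_const _).const_mul _)).add ((dcos θ).const_mul _)).congr_deriv ?_
    simp only [hXa]; ring
  have dXb : ∀ j, HasDerivAt (fun b => X j θ b) (Xb j) φ := fun j => by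
    refine (((((dcos φ).const_mul _).const_mul _).add
      (((dsin φ).const_mul _).const_mul _)).add_const _).congr_deriv ?_
    simp only [hXb]; ring
  have dWa : ∀ j, HasDerivAt (fun a => W j a φ) (Wa j) θ := fun j => by
    refine ((((((dcos θ).mul_const _).sub_const _).const_mul _).add
      ((((dcos θ).mul_const _).add_const _).const_mul _)).sub ((dsin θ).const_mul _)).div
      (dsin θ) hsC |>.congr_deriv ?_
    simp only [hWa, hX, hE, Pi.add_apply, Pi.sub_apply]; ring
  have dWb : ∀ j, HasDerivAt (fun b => W j θ b) (Eb j / Real.sin θ) φ := fun j => by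
    refine (((((((dcos φ).const_mul _).sub ((dsin φ).const_mul _)).const_mul _).add
      ((((dsin φ).const_mul _).add ((dcos φ).const_mul _)).const_mul _)).sub_const
      _).div_const _).congr_deriv ?_
    simp only [hEb]; ring
  have DX : ∀ j, Xa j + Complex.I / Real.sin θ * Xb j = E j θ φ := fun j => by
    simp only [hXa, hXb, hE]; field_simp; ring
  have hcs : (Real.cos θ : ℂ) ^ 2 = 1 - (Real.sin θ : ℂ) ^ 2 := by exact_mod_cast Real.cos_sq' θ
  have DW : ∀ j, Wa j + Complex.I / Real.sin θ * (Eb j / Real.sin θ) = 0 := fun j => by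
    simp only [hWa, hEb, hE, hX]
    field_simp
    linear_combination (-(β j 0 * Real.cos φ + β j 1 * Real.sin φ)) * hcs -
      (β j 0 * Real.cos φ + β j 1 * Real.sin φ) * Complex.I_sq
  have d1 : deriv (fun a => ((Real.sin a ^ (-(k : ℤ)) : ℝ) : ℂ) * h (sph a φ)) θ =
      ∑ j ∈ S, c j * ((n * X j θ φ ^ (n - 1) * Xa j) * W j θ φ ^ k +
        X j θ φ ^ n * (k * W j θ φ ^ (k - 1) * Wa j)) := by
    have he : (fun a => ((Real.sin a ^ (-(k : ℤ)) : ℝ) : ℂ) * h (sph a φ)) =ᶠ[𝓝 θ]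
        fun a => ∑ j ∈ S, c j * (X j a φ ^ n * W j a φ ^ k) := by
      filter_upwards [Real.continuous_sin.continuousAt.eventually (lt_mem_nhds hs)] with a ha
      exact hu a φ ha
    rw [he.deriv_eq]
    exact (HasDerivAt.fun_sum fun j _ =>
      (((dXa j).fun_pow n).mul ((dWa j).fun_pow k)).const_mul (c j)).deriv
  have d2 : deriv (fun b => ((Real.sin θ ^ (-(k : ℤ)) : ℝ) : ℂ) * h (sph θ b)) φ =
      ∑ j ∈ S, c j * ((n * X j θ φ ^ (n - 1) * Xb j) * W j θ φ ^ k +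
        X j θ φ ^ n * (k * W j θ φ ^ (k - 1) * (Eb j / Real.sin θ))) := by
    rw [funext fun b => hu θ b hs]
    exact (HasDerivAt.fun_sum fun j _ =>
      (((dXb j).fun_pow n).mul ((dWb j).fun_pow k)).const_mul (c j)).deriv
  rw [d1, d2, neg_mul, neg_inj, Finset.mul_sum, ← Finset.sum_add_distrib, Finset.mul_sum]
  refine Finset.sum_congr rfl fun j _ => ?_
  have h1 : β j ⬝ᵥ cvec p = X j θ φ := by rw [← hXe, hpe]
  have h2 : β j ⬝ᵥ tang 1 p = E j θ φ := by rw [← hEe j θ φ hs, hpe]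
  have h3 : (Real.sin θ : ℂ) ^ k * W j θ φ ^ k = E j θ φ ^ k := by
    rw [← mul_pow, hW]; congr 1; field_simp
  rw [h1, h2, pow_succ, ← h3, zpow_natCast, Complex.ofReal_pow]
  -- The product rule splits each term into a multiple of `D X = E` and a multiple of `D W = 0`.
  linear_combination (Real.sin θ : ℂ) ^ k * c j * n * X j θ φ ^ (n - 1) * W j θ φ ^ k * DX j +
    (Real.sin θ : ℂ) ^ k * c j * X j θ φ ^ n * k * W j θ φ ^ (k - 1) * DW j

/-- Rotating the argument amounts to replacing `a j` by `a j ᵥ* cmat R`, so the computation in the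
unrotated chart serves every `R`. The successive exponents `l, l - 1, …` brought down by
differentiation form the descending factorial. -/
theorem edthPow_sum_pow {J : Type*} (S : Finset J) (c : J → ℂ) (a : J → Fin 3 → ℂ) (l k : ℕ)
    {F : S2 → ℂ} (hF : ∀ p, F p = ∑ j ∈ S, c j * (a j ⬝ᵥ cvec p) ^ l)
    (R : SO3) {p : S2} (hp : p ∈ chart R) :
    edthPow k (fun _ => F) R p = (-1) ^ k * l.descFactorial k *
      ∑ j ∈ S, c j * (a j ⬝ᵥ cvec p) ^ (l - k) * (a j ⬝ᵥ tang R p) ^ k := by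
  induction k generalizing p with
  | zero => simp [edthPow, hF]
  | succ k ih =>
    have hq := mem_chart_iff.1 hp
    have key := edthI_sum_pow S (fun j => (-1) ^ k * l.descFactorial k * c j)
      (fun j => a j ᵥ* cmat R) (l - k) k (h := fun q => edthPow k (fun _ => F) R (rot R q))
      (fun q hq => by
        rw [ih (rot_mem_chart hq), Finset.mul_sum]
        refine Finset.sum_congr rfl fun j _ => ?_
        rw [cvec_rot, tang_rot, Matrix.dotProduct_mulVec, Matrix.dotProduct_mulVec]
        ring) hq
    rw [edthPow, edth, key, Finset.mul_sum, ← Finset.sum_neg_distrib]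
    refine Finset.sum_congr rfl fun j _ => ?_
    rw [← Matrix.dotProduct_mulVec, ← Matrix.dotProduct_mulVec, ← cvec_rot, ← tang_rot,
      rot_rot_inv, Nat.descFactorial_succ, Nat.sub_sub]
    push_cast
    ring

theorem edthI_const_mul (s : ℤ) (c : ℂ) (h : S2 → ℂ) (p : S2) :
    edthI s (fun q => c * h q) p = c * edthI s h p := by
  simp only [edthI, mul_left_comm _ c, deriv_const_mul_field]
  ring

/-- Reduces negative spin to `∂`. The sign here cancels the `(-1)^k` produced by `∂^k`, which is why
`spinVec` carries a minus sign only for `s ≥ 0`. -/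
theorem negEdthBarPow_eq (k : ℕ) (f : Family) (R : SO3) (p : S2) :
    negEdthBarPow k f R p = (-1) ^ k * conj (edthPow k (conjF f) R p) := by
  induction k generalizing p with
  | zero => simp [negEdthBarPow, edthPow, conjF]
  | succ k ih =>
    simp only [negEdthBarPow, edthPow, Pi.neg_apply, edthBar, conjF, edth, neg_neg, ih, map_mul,
      map_pow, map_neg, map_one, Complex.conj_conj, edthI_const_mul]
    ring

theorem negEdthBarPow_sum_pow {J : Type*} (S : Finset J) (c : J → ℂ) (a : J → Fin 3 → ℂ)
    (l k : ℕ) {F : S2 → ℂ} (hF : ∀ p, F p = ∑ j ∈ S, c j * (a j ⬝ᵥ cvec p) ^ l)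
    (R : SO3) {p : S2} (hp : p ∈ chart R) :
    negEdthBarPow k (fun _ => F) R p = l.descFactorial k *
      ∑ j ∈ S, c j * (a j ⬝ᵥ cvec p) ^ (l - k) * (a j ⬝ᵥ star (tang R p)) ^ k := by
  have hc : ∀ q : S2, star (cvec q) = cvec q := fun q => by
    ext i; simp [cvec]
  have hconj : ∀ v w : Fin 3 → ℂ, conj (v ⬝ᵥ w) = star v ⬝ᵥ star w := fun v w => by
    simp [dotProduct, map_sum]
  have hcF : conjF (fun _ => F) = fun _ p => conj (F p) := rfl
  rw [negEdthBarPow_eq, hcF, edthPow_sum_pow S (fun j => conj (c j)) (fun j => star (a j)) l k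
    (fun p => ?_) R hp]
  · simp only [map_mul, map_sum, map_pow, map_neg, map_one, Complex.conj_conj, hconj, star_star,
      hc, Complex.conj_natCast]
    rw [← mul_assoc, ← mul_assoc, ← mul_pow]
    norm_num
  · simp only [hF, map_sum, map_mul, map_pow, hconj, hc]

/-! ### Binary forms attached to frames -/

/-- The null vector with parameter `z`. -/
def nullVec (z : ℂ) : Fin 3 → ℂ := ![(z ^ 2 - 1) / 2, Complex.I * (z ^ 2 + 1) / 2, z]

/-- The polynomial `z ↦ nullVec z ⬝ᵥ v`. -/
def nullPoly (v : Fin 3 → ℂ) : Polynomial ℂ :=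
  Polynomial.C ((v 0 + Complex.I * v 1) / 2) * Polynomial.X ^ 2 +
    Polynomial.C (v 2) * Polynomial.X - Polynomial.C ((v 0 - Complex.I * v 1) / 2)

theorem eval_nullPoly (v : Fin 3 → ℂ) (z : ℂ) : (nullPoly v).eval z = nullVec z ⬝ᵥ v := by
  simp [nullPoly, nullVec, dotProduct, Fin.sum_univ_three]
  ring

theorem natDegree_nullPoly_le (v : Fin 3 → ℂ) : (nullPoly v).natDegree ≤ 2 := by
  unfold nullPoly
  compute_degree

theorem nullPoly_smul (c : ℂ) (v : Fin 3 → ℂ) :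
    nullPoly (c • v) = Polynomial.C c * nullPoly v := by
  apply Polynomial.funext
  intro z
  simp [eval_nullPoly]

/-- The null vector of the frame, with the type and sign adapted to spin `s`. -/
def spinVec (s : ℤ) (R : SO3) (p : S2) : Fin 3 → ℂ :=
  if 0 ≤ s then -tang R p else star (tang R p)

/-- The generating polynomial of the spin `s` harmonics of degree `l`. -/
def spinPoly (l : ℕ) (s : ℤ) (R : SO3) (p : S2) : Polynomial ℂ :=
  nullPoly (cvec p) ^ (l - s.natAbs) * nullPoly (spinVec s R p) ^ s.natAbs

theorem natDegree_spinPoly_le {l : ℕ} {s : ℤ} (hs : s.natAbs ≤ l) (R : SO3) (p : S2) :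
    (spinPoly l s R p).natDegree ≤ 2 * l := by
  refine Polynomial.natDegree_mul_le.trans ?_
  have h1 := Polynomial.natDegree_pow_le_of_le (l - s.natAbs) (natDegree_nullPoly_le (cvec p))
  have h2 := Polynomial.natDegree_pow_le_of_le s.natAbs (natDegree_nullPoly_le (spinVec s R p))
  omega

/-- Lagrange interpolation at `0, …, n`, with weights independent of `P`. It writes a coefficient of
a power of `nullPoly` as a finite sum of powers of linear forms, on which `∂` has been computed, and
later serves for smoothness. -/
theorem exists_coeff_eq_sum_eval (n i : ℕ) : ∃ w : ℕ → ℂ, ∀ P : Polynomial ℂ,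
    P.natDegree ≤ n → P.coeff i = ∑ j ∈ Finset.range (n + 1), w j * P.eval (j : ℂ) := by
  refine ⟨fun j => (Lagrange.basis (Finset.range (n + 1)) (fun j : ℕ => (j : ℂ)) j).coeff i,
    fun P hP => ?_⟩
  have hd : P.degree < (Finset.range (n + 1)).card := by
    rw [Finset.card_range]
    exact Polynomial.degree_le_natDegree.trans_lt (by exact_mod_cast Nat.lt_succ_of_le hP)
  have h := Lagrange.eq_interpolate (Nat.cast_injective.injOn (s := _) (f := ((↑) : ℕ → ℂ))) hd
  conv_lhs => rw [h, Lagrange.interpolate_apply, Polynomial.finsetSum_coeff]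
  refine Finset.sum_congr rfl fun j _ => ?_
  rw [Polynomial.coeff_C_mul, mul_comm]

theorem coeff_linear_pow {K : Type*} [CommRing K] (a b : K) (n i : ℕ) :
    ((Polynomial.C a * Polynomial.X + Polynomial.C b) ^ n).coeff i =
      a ^ i * b ^ (n - i) * n.choose i := by
  rw [add_pow, Polynomial.finsetSum_coeff]
  have h : ∀ k ∈ Finset.range (n + 1), ((Polynomial.C a * Polynomial.X) ^ k *
      Polynomial.C b ^ (n - k) * (n.choose k : Polynomial K)).coeff i =
      if i = k then a ^ i * b ^ (n - i) * n.choose i else 0 := by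
    intro k _
    rw [mul_pow, ← Polynomial.C_pow, ← Polynomial.C_pow, ← Polynomial.C_eq_natCast,
      Polynomial.coeff_mul_C, Polynomial.coeff_mul_C, Polynomial.coeff_C_mul_X_pow]
    split_ifs with hik
    · rw [hik]
    · simp
  rw [Finset.sum_congr rfl h, Finset.sum_ite_eq]
  split_ifs with hi
  · rfl
  · rw [Nat.choose_eq_zero_of_lt (by simpa using hi)]
    simp

/-- The binary form `(c z - s)^a (s z + c)^b`, with `c = cos (θ/2)` and `s = sin (θ/2)`. -/
def wignerPoly (a b : ℕ) (θ : ℝ) : Polynomial ℝ :=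
  (Polynomial.C (Real.cos (θ / 2)) * Polynomial.X + Polynomial.C (-Real.sin (θ / 2))) ^ a *
    (Polynomial.C (Real.sin (θ / 2)) * Polynomial.X + Polynomial.C (Real.cos (θ / 2))) ^ b

theorem coeff_wignerPoly (a b : ℕ) (θ : ℝ) (i : ℕ) :
    (wignerPoly a b θ).coeff i = ∑ r ∈ Finset.range (a + 1),
      if r ≤ i then Real.cos (θ / 2) ^ r * (-Real.sin (θ / 2)) ^ (a - r) * a.choose r *
        (Real.sin (θ / 2) ^ (i - r) * Real.cos (θ / 2) ^ (b - (i - r)) * b.choose (i - r))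
      else 0 := by
  rw [wignerPoly, add_pow, Finset.sum_mul, Polynomial.finsetSum_coeff]
  refine Finset.sum_congr rfl fun r _ => ?_
  rw [mul_pow, ← Polynomial.C_pow, ← Polynomial.C_pow, ← Polynomial.C_eq_natCast]
  rw [show ∀ x y z w q : Polynomial ℝ, x * y * z * w * q = x * z * w * (y * q) by intros; ring,
    ← Polynomial.C_mul, ← Polynomial.C_mul, Polynomial.coeff_C_mul,
    Polynomial.coeff_X_pow_mul']
  split_ifs
  · rw [coeff_linear_pow]
  · simp

theorem nullPoly_cvec_sph (θ φ : ℝ) : nullPoly (cvec (sph θ φ)) =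
    Polynomial.C (Complex.exp (-(Complex.I * φ))) *
      ((wignerPoly 1 1 θ).map (algebraMap ℝ ℂ)).comp
        (Polynomial.C (Complex.exp (Complex.I * φ)) * Polynomial.X) := by
  apply Polynomial.funext
  intro z
  have hw : Complex.exp (-(Complex.I * φ)) * Complex.exp (Complex.I * φ) = 1 := by
    rw [← Complex.exp_add]; simp
  have h1 : Complex.exp (Complex.I * φ) = Complex.cos φ + Complex.I * Complex.sin φ := by
    rw [mul_comm, Complex.exp_mul_I]; ring
  have h2 : Complex.exp (-(Complex.I * φ)) = Complex.cos φ - Complex.I * Complex.sin φ := by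
    rw [mul_comm, ← neg_mul, Complex.exp_mul_I, Complex.cos_neg, Complex.sin_neg]
    ring
  have hs : Complex.sin θ = 2 * Complex.sin (θ / 2) * Complex.cos (θ / 2) := by
    rw [← Complex.sin_two_mul]; congr 1; ring
  have hc : Complex.cos θ = Complex.cos (θ / 2) ^ 2 - Complex.sin (θ / 2) ^ 2 := by
    rw [← Complex.cos_two_mul']; congr 1; ring
  rw [nullPoly, cvec_sph]
  simp [wignerPoly]
  rw [hs, hc]
  set w := Complex.exp (Complex.I * φ)
  set w' := Complex.exp (-(Complex.I * φ))
  set c := Complex.cos (θ / 2)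
  set s := Complex.sin (θ / 2)
  linear_combination (-s * c * z ^ 2) * h1 + s * c * h2 -
    (c * s * w * z ^ 2 + (c ^ 2 - s ^ 2) * z) * hw

theorem nullPoly_spinVec_sph (s : ℤ) {θ : ℝ} (φ : ℝ) (hθ : 0 < Real.sin θ) :
    nullPoly (spinVec s 1 (sph θ φ)) =
    Polynomial.C (Complex.exp (-(Complex.I * φ))) *
      ((if 0 ≤ s then wignerPoly 0 2 θ else wignerPoly 2 0 θ).map (algebraMap ℝ ℂ)).comp
        (Polynomial.C (Complex.exp (Complex.I * φ)) * Polynomial.X) := by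
  apply Polynomial.funext
  intro z
  have hw : Complex.exp (-(Complex.I * φ)) * Complex.exp (Complex.I * φ) = 1 := by
    rw [← Complex.exp_add]; simp
  have h1 : Complex.exp (Complex.I * φ) = Complex.cos φ + Complex.I * Complex.sin φ := by
    rw [mul_comm, Complex.exp_mul_I]; ring
  have h2 : Complex.exp (-(Complex.I * φ)) = Complex.cos φ - Complex.I * Complex.sin φ := by
    rw [mul_comm, ← neg_mul, Complex.exp_mul_I, Complex.cos_neg, Complex.sin_neg]
    ring
  have hs : Complex.sin θ = 2 * Complex.sin (θ / 2) * Complex.cos (θ / 2) := by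
    rw [← Complex.sin_two_mul]; congr 1; ring
  have hc : Complex.cos θ = 2 * Complex.cos (θ / 2) ^ 2 - 1 := by
    rw [← Complex.cos_two_mul]; congr 1; ring
  have hsc := Complex.sin_sq_add_cos_sq (θ / 2)
  rw [nullPoly, spinVec, tang_one_sph φ hθ]
  split_ifs
  · simp [wignerPoly]
    rw [hs, hc]
    set w := Complex.exp (Complex.I * φ)
    set w' := Complex.exp (-(Complex.I * φ))
    set c := Complex.cos (θ / 2)
    set s := Complex.sin (θ / 2)
    set x := Complex.cos φ
    set y := Complex.sin φ
    linear_combination (-s ^ 2 * z ^ 2) * h1 - c ^ 2 * h2 -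
      (s ^ 2 * w * z ^ 2 + 2 * s * c * z) * hw + (-(x + Complex.I * y) * z ^ 2) * hsc -
      x / 2 * (1 + z ^ 2) * Complex.I_sq
  · simp [wignerPoly]
    simp only [← Complex.cos_conj, ← Complex.sin_conj, Complex.conj_ofReal]
    rw [hs, hc]
    set w := Complex.exp (Complex.I * φ)
    set w' := Complex.exp (-(Complex.I * φ))
    set c := Complex.cos (θ / 2)
    set s := Complex.sin (θ / 2)
    set x := Complex.cos φ
    set y := Complex.sin φ
    linear_combination (-c ^ 2 * z ^ 2) * h1 - s ^ 2 * h2 -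
      (c ^ 2 * w * z ^ 2 - 2 * s * c * z) * hw + (Complex.I * y - x) * hsc -
      x / 2 * (1 + z ^ 2) * Complex.I_sq

/-- The point contributes both linear factors once, and the tangent vector contributes one of them
twice. The sign of `s` decides which, so the exponents become `l - s` and `l + s` in both cases. -/
theorem spinPoly_sph {l : ℕ} {s : ℤ} (hs : s.natAbs ≤ l) {θ : ℝ} (φ : ℝ) (hθ : 0 < Real.sin θ) :
    spinPoly l s 1 (sph θ φ) = Polynomial.C (Complex.exp (-(Complex.I * φ)) ^ l) *
      ((wignerPoly (l - s).toNat (l + s).toNat θ).map (algebraMap ℝ ℂ)).comp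
        (Polynomial.C (Complex.exp (Complex.I * φ)) * Polynomial.X) := by
  rw [spinPoly, nullPoly_cvec_sph, nullPoly_spinVec_sph s φ hθ]
  have h : wignerPoly 1 1 θ ^ (l - s.natAbs) *
      (if 0 ≤ s then wignerPoly 0 2 θ else wignerPoly 2 0 θ) ^ s.natAbs =
      wignerPoly (l - s).toNat (l + s).toNat θ := by
    split_ifs with h0
    · rw [show (l - s).toNat = l - s.natAbs by omega,
        show (l + s).toNat = l - s.natAbs + 2 * s.natAbs by omega]
      simp only [wignerPoly]
      generalize Polynomial.C (Real.cos (θ / 2)) *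
        Polynomial.X + Polynomial.C (-Real.sin (θ / 2)) = A
      generalize Polynomial.C (Real.sin (θ / 2)) *
        Polynomial.X + Polynomial.C (Real.cos (θ / 2)) = B
      ring
    · rw [show (l + s).toNat = l - s.natAbs by omega,
        show (l - s).toNat = l - s.natAbs + 2 * s.natAbs by omega]
      simp only [wignerPoly]
      generalize Polynomial.C (Real.cos (θ / 2)) *
        Polynomial.X + Polynomial.C (-Real.sin (θ / 2)) = A
      generalize Polynomial.C (Real.sin (θ / 2)) *
        Polynomial.X + Polynomial.C (Real.cos (θ / 2)) = B
      ring
  rw [← h, mul_pow, mul_pow, ← Polynomial.C_pow, ← Polynomial.C_pow, ← Polynomial.pow_comp,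
    ← Polynomial.pow_comp, ← Polynomial.map_pow, ← Polynomial.map_pow, Polynomial.map_mul,
    Polynomial.mul_comp,
    show Complex.exp (-(Complex.I * φ)) ^ l = Complex.exp (-(Complex.I * φ)) ^ (l - s.natAbs) *
      Complex.exp (-(Complex.I * φ)) ^ s.natAbs by rw [← pow_add]; congr 1; omega,
    Polynomial.C_mul]
  ring

theorem exp_neg_pow_mul_exp_pow (l i : ℕ) (φ : ℝ) :
    Complex.exp (-(Complex.I * φ)) ^ l * Complex.exp (Complex.I * φ) ^ i =
      Complex.exp (Complex.I * ((i - l : ℤ) : ℂ) * φ) := by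
  rw [← Complex.exp_nat_mul, ← Complex.exp_nat_mul, ← Complex.exp_add]
  congr 1
  push_cast
  ring

theorem coeff_spinPoly_sph {l : ℕ} {s : ℤ} (hs : s.natAbs ≤ l) {θ : ℝ} (φ : ℝ)
    (hθ : 0 < Real.sin θ) (i : ℕ) :
    (spinPoly l s 1 (sph θ φ)).coeff i = Complex.exp (Complex.I * ((i - l : ℤ) : ℂ) * φ) *
      ((wignerPoly (l - s).toNat (l + s).toNat θ).coeff i : ℝ) := by
  rw [spinPoly_sph hs φ hθ, Polynomial.coeff_C_mul, Polynomial.comp_C_mul_X_coeff,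
    Polynomial.coeff_map, ← exp_neg_pow_mul_exp_pow]
  simp
  ring

/-! ### The harmonics as coefficients -/

theorem Y_eq_coeff (l i : ℕ) (p : S2) :
    Y l ((i : ℤ) - l) p = (((-1) ^ (l - i) * (aCoeff l ((i : ℤ) - l) / l.factorial) : ℝ) : ℂ) *
      (nullPoly (cvec p) ^ l).coeff i := by
  have h1 : (nullPoly (cvec p) ^ l).coeff i =
      Complex.exp (Complex.I * ((i - l : ℤ) : ℂ) * azimuth p) *
      ((wignerPoly l l (polar p)).coeff i : ℝ) := by
    conv_lhs => rw [← sph_polar_azimuth p]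
    rw [nullPoly_cvec_sph, mul_pow, ← Polynomial.C_pow, ← Polynomial.pow_comp,
      ← Polynomial.map_pow, Polynomial.coeff_C_mul, Polynomial.comp_C_mul_X_coeff,
      Polynomial.coeff_map, ← exp_neg_pow_mul_exp_pow,
      show wignerPoly 1 1 (polar p) ^ l = wignerPoly l l (polar p) by
        simp only [wignerPoly, pow_one, mul_pow]]
    simp
    ring
  have h2 : (wignerPoly l l (polar p)).coeff i = ∑ r ∈ Finset.range (l + 1),
      (l.choose r : ℝ) * binom l ((r : ℤ) - ((i : ℤ) - l)) * (-1) ^ (l - r) *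
          Real.sin (polar p / 2) ^ (2 * (l : ℤ) - 2 * r + ((i : ℤ) - l)).toNat *
          Real.cos (polar p / 2) ^ (2 * (r : ℤ) - ((i : ℤ) - l)).toNat := by
    rw [coeff_wignerPoly]
    -- With `m = i - l`, symmetry gives `C(l, i - r) = C(l, r - m)`. For `i < r` or `i - r > l` both
    -- sides vanish, through the upper or the lower end of the range of the binomial coefficient.
    refine Finset.sum_congr rfl fun r hr => ?_
    have hr' : r ≤ l := by simpa [Nat.lt_succ_iff] using hr
    unfold binom
    by_cases h3 : r ≤ i
    · rw [if_pos h3]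
      by_cases h4 : i - r ≤ l
      · rw [if_pos (by omega), show ((r : ℤ) - ((i : ℤ) - l)).toNat = l - (i - r) by omega,
          Nat.choose_symm h4,
          show (2 * (l : ℤ) - 2 * r + ((i : ℤ) - l)).toNat = (l - r) + (i - r) by omega,
          show (2 * (r : ℤ) - ((i : ℤ) - l)).toNat = r + (l - (i - r)) by omega, pow_add, pow_add,
          neg_pow (Real.sin _)]
        ring
      · rw [if_neg (by omega), Nat.choose_eq_zero_of_lt (by omega : l < i - r)]
        simp
    · rw [if_neg h3, if_pos (by omega),
        Nat.choose_eq_zero_of_lt (by omega : l < ((r : ℤ) - ((i : ℤ) - l)).toNat)]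
      simp
  -- The truncated subtraction `l - i` is exactly `m⁻` for `m = i - l`.
  rw [h1, h2, Y, show (-((i : ℤ) - l)).toNat = l - i by omega]
  push_cast
  ring

/-- The normalization of `_sY_{lm}`, for `m = i - l`. -/
def spinCoeff (l : ℕ) (s : ℤ) (i : ℕ) : ℝ :=
  Real.sqrt (zfact (l - s.natAbs) / zfact (l + s.natAbs)) *
    ((-1) ^ (l - i) * (aCoeff l ((i : ℤ) - l) / l.factorial)) * l.descFactorial s.natAbs

theorem sY_eq_coeff {l i : ℕ} {s : ℤ} (hs : s.natAbs ≤ l) (R : SO3) {p : S2}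
    (hp : p ∈ chart R) :
    sY l s ((i : ℤ) - l) R p = spinCoeff l s i * (spinPoly l s R p).coeff i := by
  obtain ⟨w, hw⟩ := exists_coeff_eq_sum_eval (2 * l) i
  set κ : ℂ := (((-1) ^ (l - i) * (aCoeff l ((i : ℤ) - l) / l.factorial) : ℝ) : ℂ) with hκ
  -- Interpolation turns `Y_{lm}` into a sum of `l`-th powers of linear forms. The same weights then
  -- reassemble the coefficient of `spinPoly` after differentiation.
  have hF : ∀ p, Y l ((i : ℤ) - l) p = ∑ j ∈ Finset.range (2 * l + 1),
      (κ * w j) * (nullVec (j : ℂ) ⬝ᵥ cvec p) ^ l := fun p => by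
    rw [Y_eq_coeff, hw _ (by
      simpa [mul_comm] using Polynomial.natDegree_pow_le_of_le l (natDegree_nullPoly_le (cvec p))),
      Finset.mul_sum]
    simp [eval_nullPoly, hκ, mul_assoc]
  rw [hw _ (natDegree_spinPoly_le hs R p), spinCoeff]
  simp only [spinPoly, Polynomial.eval_mul, Polynomial.eval_pow, eval_nullPoly, spinVec]
  unfold sY
  by_cases h0 : 0 ≤ s
  · simp only [if_pos h0, Pi.smul_apply, smul_eq_mul]
    rw [show s.toNat = s.natAbs by omega, edthPow_sum_pow _ _ _ l _ hF R hp,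
      show (l : ℤ) - s = l - s.natAbs by omega, show (l : ℤ) + s = l + s.natAbs by omega]
    push_cast
    rw [Finset.mul_sum, Finset.mul_sum, Finset.mul_sum]
    refine Finset.sum_congr rfl fun j _ => ?_
    rw [dotProduct_neg, neg_pow (nullVec _ ⬝ᵥ tang R p)]
    simp only [hκ]
    push_cast
    ring
  · simp only [if_neg h0, Pi.smul_apply, smul_eq_mul]
    rw [show (-s).toNat = s.natAbs by omega, negEdthBarPow_sum_pow _ _ _ l _ hF R hp,
      show (l : ℤ) + s = l - s.natAbs by omega, show (l : ℤ) - s = l + s.natAbs by omega]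
    push_cast
    rw [Finset.mul_sum, Finset.mul_sum, Finset.mul_sum]
    refine Finset.sum_congr rfl fun j _ => ?_
    simp only [hκ]
    push_cast
    ring

/-! ### Sums over binary forms -/

theorem coeff_eq_zero_of_sum_pow {K : Type*} [Field K] [CharZero K] {N : ℕ} {c : ℕ → K}
    (h : ∀ x : ℕ, ∑ i ∈ Finset.range N, c i * (x : K) ^ i = 0) {i : ℕ} (hi : i < N) : c i = 0 := by
  set P : Polynomial K := ∑ i ∈ Finset.range N, Polynomial.C (c i) * Polynomial.X ^ i with hP
  have h0 : P = 0 := by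
    apply Polynomial.eq_zero_of_infinite_isRoot
    refine (Set.infinite_range_of_injective (Nat.cast_injective (R := K))).mono ?_
    rintro _ ⟨x, rfl⟩
    simpa [hP, Polynomial.eval_finsetSum] using h x
  have h1 : P.coeff i = c i := by
    rw [hP, Polynomial.finsetSum_coeff]
    simp only [Polynomial.coeff_C_mul_X_pow]
    rw [Finset.sum_ite_eq, if_pos (Finset.mem_range.2 hi)]
  rw [← h1, h0, Polynomial.coeff_zero]

theorem coeff_eq_zero_of_sum_pow₂ {K : Type*} [Field K] [CharZero K] {N : ℕ} {c : ℕ → ℕ → K}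
    (h : ∀ x y : ℕ, ∑ i ∈ Finset.range N, ∑ j ∈ Finset.range N,
      c i j * (x : K) ^ i * (y : K) ^ j = 0) {i j : ℕ} (hi : i < N) (hj : j < N) : c i j = 0 := by
  refine coeff_eq_zero_of_sum_pow (c := c i) (fun y => ?_) hj
  refine coeff_eq_zero_of_sum_pow (c := fun i => ∑ j ∈ Finset.range N, c i j * (y : K) ^ j)
    (fun x => ?_) hi
  rw [← h x y]
  refine Finset.sum_congr rfl fun i _ => ?_
  rw [Finset.sum_mul]
  exact Finset.sum_congr rfl fun j _ => by ring

theorem sum_delta_choose {K : Type*} [Field K] (N : ℕ) (x y : K) :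
    ∑ i ∈ Finset.range (N + 1), ∑ j ∈ Finset.range (N + 1),
      (if i = j then (N.choose i : K) else 0) * x ^ i * y ^ j = (1 + y * x) ^ N := by
  rw [add_comm 1 (y * x), add_pow]
  refine Finset.sum_congr rfl fun i hi => ?_
  rw [Finset.sum_eq_single i]
  · rw [if_pos rfl, one_pow, mul_pow]
    ring
  · intro j _ hj
    rw [if_neg hj.symm]
    ring
  · exact fun h => absurd hi h

/-- Summed over `a` by the binomial theorem, the forms collapse to the `N`-th power of a single
linear form in the polynomial variable. -/
theorem sum_choose_mul_coeff_wignerPoly (N : ℕ) (θ t : ℝ) (i : ℕ) :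
    ∑ a ∈ Finset.range (N + 1), N.choose a * (wignerPoly a (N - a) θ).coeff i * t ^ a =
      (Real.sin (θ / 2) + t * Real.cos (θ / 2)) ^ i *
        (Real.cos (θ / 2) - t * Real.sin (θ / 2)) ^ (N - i) * N.choose i := by
  rw [← coeff_linear_pow]
  have : Polynomial.C (Real.sin (θ / 2) + t * Real.cos (θ / 2)) * Polynomial.X +
      Polynomial.C (Real.cos (θ / 2) - t * Real.sin (θ / 2)) =
      Polynomial.C t * (Polynomial.C (Real.cos (θ / 2)) * Polynomial.X +
        Polynomial.C (-Real.sin (θ / 2))) +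
      (Polynomial.C (Real.sin (θ / 2)) * Polynomial.X + Polynomial.C (Real.cos (θ / 2))) := by
    simp only [Polynomial.C_add, Polynomial.C_sub, Polynomial.C_mul, Polynomial.C_neg]
    ring
  rw [this, add_pow, Polynomial.finsetSum_coeff]
  refine Finset.sum_congr rfl fun a _ => ?_
  rw [mul_pow, ← Polynomial.C_pow, ← Polynomial.C_eq_natCast, Polynomial.coeff_mul_C, mul_assoc
    (Polynomial.C _), Polynomial.coeff_C_mul, wignerPoly]
  ring

/-- Unitarity of the rotation on binary forms of degree `N`, for the norm weighted by `1 / C(N, i)`.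
Multiplying two generating functions in `a`, with parameters `x` and `y`, and summing over `i` gives
`(1 + xy)^N`, since the half-angle rotation preserves the scalar product of `(x, 1)` and `(y, 1)`.
Comparing coefficients gives the identity. -/
theorem sum_sq_coeff_wignerPoly (a b : ℕ) (θ : ℝ) :
    ∑ i ∈ Finset.range (a + b + 1), (wignerPoly a b θ).coeff i ^ 2 / (a + b).choose i =
      1 / (a + b).choose a := by
  obtain ⟨N, hN⟩ : ∃ N, N = a + b := ⟨_, rfl⟩
  obtain rfl : b = N - a := by omega
  rw [← hN]
  have ha : a < N + 1 := by omega
  have key := coeff_eq_zero_of_sum_pow₂ (K := ℝ) (N := N + 1)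
    (c := fun a a' => N.choose a * N.choose a' * (∑ i ∈ Finset.range (N + 1),
      (wignerPoly a (N - a) θ).coeff i * (wignerPoly a' (N - a') θ).coeff i / N.choose i) -
      if a = a' then (N.choose a : ℝ) else 0) (fun x y => ?_) ha ha
  · simp only [if_true] at key
    have h0 : (N.choose a : ℝ) ≠ 0 := by
      exact_mod_cast (Nat.choose_pos (by omega)).ne'
    rw [eq_div_iff h0]
    apply mul_left_cancel₀ h0
    simp only [sq]
    linear_combination key
  · simp only [sub_mul, Finset.sum_sub_distrib]
    rw [sum_delta_choose, sub_eq_zero]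
    calc _ = ∑ i ∈ Finset.range (N + 1), (∑ a ∈ Finset.range (N + 1),
            N.choose a * (wignerPoly a (N - a) θ).coeff i * (x : ℝ) ^ a) *
          (∑ a ∈ Finset.range (N + 1),
            N.choose a * (wignerPoly a (N - a) θ).coeff i * (y : ℝ) ^ a) / N.choose i := by
          simp only [Finset.sum_div, Finset.mul_sum, Finset.sum_mul]
          rw [Finset.sum_congr rfl fun a _ => Finset.sum_comm, Finset.sum_comm]
          refine Finset.sum_congr rfl fun i _ => ?_
          rw [Finset.sum_comm]
          refine Finset.sum_congr rfl fun a _ => Finset.sum_congr rfl fun a' _ => ?_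
          ring
      _ = _ := by
          simp only [sum_choose_mul_coeff_wignerPoly]
          set S := Real.sin (θ / 2)
          set C := Real.cos (θ / 2)
          have h1 : 1 + (y : ℝ) * x = (S + x * C) * (S + y * C) + (C - x * S) * (C - y * S) := by
            linear_combination (-(1 + (y : ℝ) * x)) * Real.sin_sq_add_cos_sq (θ / 2)
          rw [h1, add_pow]
          refine Finset.sum_congr rfl fun i hi => ?_
          have h0 : (N.choose i : ℝ) ≠ 0 := by
            exact_mod_cast (Nat.choose_pos (by simpa [Nat.lt_succ_iff] using hi)).ne'
          rw [mul_pow, mul_pow]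
          field_simp

/-- This is the reciprocal of the diagonal Gram entry obtained from `gram_eq` and `gram_zero_zero`.
-/
theorem spinCoeff_sq {l i : ℕ} {s : ℤ} (hs : s.natAbs ≤ l) (hi : i ≤ 2 * l) :
    spinCoeff l s i ^ 2 =
      (2 * l + 1) / (4 * Real.pi) * (2 * l).choose (l - s).toNat / (2 * l).choose i := by
  have h1 : (2 * l).choose (l - s).toNat = (2 * l).choose (l - s.natAbs) := by
    rcases le_total 0 s with h | h
    · congr 1; omega
    · rw [← Nat.choose_symm (by omega)]; congr 1; omega
  set k := s.natAbs
  have e1 := Nat.choose_mul_factorial_mul_factorial hi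
  have e2 := Nat.choose_mul_factorial_mul_factorial (show l - k ≤ 2 * l by omega)
  have e3 := Nat.factorial_mul_descFactorial hs
  rw [show 2 * l - (l - k) = l + k by omega] at e2
  have c1 : ((2 * l).choose i : ℝ) = (2 * l).factorial / (i.factorial * (2 * l - i).factorial) := by
    rw [eq_div_iff (by positivity), ← mul_assoc]; exact_mod_cast e1
  have c2 : ((2 * l).choose (l - k) : ℝ) =
      (2 * l).factorial / ((l - k).factorial * (l + k).factorial) := by
    rw [eq_div_iff (by positivity), ← mul_assoc]; exact_mod_cast e2
  have c3 : (l.descFactorial k : ℝ) = l.factorial / (l - k).factorial := by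
    rw [eq_div_iff (by positivity), mul_comm]; exact_mod_cast e3
  rw [h1, c1, c2, spinCoeff, aCoeff, c3]
  unfold zfact
  rw [show ((l : ℤ) - k).toNat = l - k by omega, show ((l : ℤ) + k).toNat = l + k by omega,
    show ((l : ℤ) + (i - l)).toNat = i by omega,
    show ((l : ℤ) - (i - l)).toNat = 2 * l - i by omega]
  rw [mul_pow, mul_pow, Real.sq_sqrt (by positivity), mul_pow, div_pow, Real.sq_sqrt (by positivity),
    ← pow_mul, mul_comm (l - i), pow_mul, neg_one_sq, one_pow]
  have hpi := Real.pi_pos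
  field_simp

theorem sum_sq_norm_coeff_spinPoly {l : ℕ} {s : ℤ} (hs : s.natAbs ≤ l) {p : S2}
    (hp : p ∈ chart 1) :
    ∑ i ∈ Finset.range (2 * l + 1), ‖(spinPoly l s 1 p).coeff i‖ ^ 2 / (2 * l).choose i =
      1 / (2 * l).choose (l - s).toNat := by
  have h0 := Real.sin_pos_of_mem_Ioo (polar_mem (mem_chart_one.1 hp))
  have h := sum_sq_coeff_wignerPoly (l - s).toNat (l + s).toNat (polar p)
  rw [show (l - s).toNat + (l + s).toNat = 2 * l by omega] at h
  rw [← h]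
  refine Finset.sum_congr rfl fun i _ => ?_
  conv_lhs => rw [← sph_polar_azimuth p]
  rw [coeff_spinPoly_sph hs _ h0, norm_mul,
    show Complex.I * ((i - l : ℤ) : ℂ) * (azimuth p : ℂ) = ((((i - l : ℤ) : ℝ) * azimuth p : ℝ) : ℂ)
      * Complex.I by push_cast; ring, Complex.norm_exp_ofReal_mul_I, one_mul, Complex.norm_real,
    Real.norm_eq_abs, sq_abs]

/-! ### Smoothness -/

/-- The extension of `ρ_R` to a vector field that is smooth off an axis of `ℝ³`. -/
def refExt (R : SO3) (q : E3) : Fin 3 → ℝ :=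
  R.1 *ᵥ ((Real.sqrt (((R⁻¹).1 *ᵥ q.ofLp) 0 ^ 2 + ((R⁻¹).1 *ᵥ q.ofLp) 1 ^ 2))⁻¹ •
    ![-((R⁻¹).1 *ᵥ q.ofLp) 1, ((R⁻¹).1 *ᵥ q.ofLp) 0, 0])

/-- The complement of the axis of the chart `U_R`. -/
def offAxis (R : SO3) : Set E3 :=
  {q | ((R⁻¹).1 *ᵥ q.ofLp) 0 ^ 2 + ((R⁻¹).1 *ᵥ q.ofLp) 1 ^ 2 ≠ 0}

theorem ref_eq_refExt {R : SO3} {p : S2} (hp : p ∈ chart R) : ref R p = refExt R p.1 := by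
  rw [ref, refI_eq (mem_chart_iff.1 hp)]
  rfl

theorem coe_mem_offAxis {R : SO3} {p : S2} (hp : p ∈ chart R) : p.1 ∈ offAxis R := by
  have h := Real.sin_pos_of_mem_Ioo (polar_mem (mem_chart_iff.1 hp))
  change (rot R⁻¹ p).1 0 ^ 2 + (rot R⁻¹ p).1 1 ^ 2 ≠ 0
  rw [apply_zero_eq, apply_one_eq, mul_pow, mul_pow, ← mul_add, Real.cos_sq_add_sin_sq]
  positivity

theorem contDiffOn_refExt (R : SO3) (i : Fin 3) :
    ContDiffOn ℝ ∞ (fun q => refExt R q i) (offAxis R) := by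
  have hv : ∀ j, ContDiff ℝ ∞ (fun q : E3 => ((R⁻¹).1 *ᵥ q.ofLp) j) := fun j => by
    simp only [Matrix.mulVec, dotProduct, Fin.sum_univ_three]
    fun_prop
  have hn : ContDiffOn ℝ ∞ (fun q : E3 => (Real.sqrt (((R⁻¹).1 *ᵥ q.ofLp) 0 ^ 2 +
      ((R⁻¹).1 *ᵥ q.ofLp) 1 ^ 2))⁻¹) (offAxis R) := by
    refine ContDiffOn.inv (ContDiffOn.sqrt (((hv 0).pow 2).add ((hv 1).pow 2)).contDiffOn
      fun q hq => hq) fun q hq => ?_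
    have : 0 ≤ ((R⁻¹).1 *ᵥ q.ofLp) 0 ^ 2 + ((R⁻¹).1 *ᵥ q.ofLp) 1 ^ 2 := by positivity
    exact (Real.sqrt_pos.2 (lt_of_le_of_ne this (Ne.symm hq))).ne'
  have h0 := (hv 0).contDiffOn (s := offAxis R)
  have h1 := (hv 1).contDiffOn (s := offAxis R)
  have he : (fun q => refExt R q i) = fun q : E3 => R.1 i 0 * ((Real.sqrt (((R⁻¹).1 *ᵥ q.ofLp) 0 ^ 2
      + ((R⁻¹).1 *ᵥ q.ofLp) 1 ^ 2))⁻¹ * -((R⁻¹).1 *ᵥ q.ofLp) 1) +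
      R.1 i 1 * ((Real.sqrt (((R⁻¹).1 *ᵥ q.ofLp) 0 ^ 2
      + ((R⁻¹).1 *ᵥ q.ofLp) 1 ^ 2))⁻¹ * ((R⁻¹).1 *ᵥ q.ofLp) 0) := by
    ext q
    rw [refExt, Matrix.mulVec, dotProduct, Fin.sum_univ_three]
    simp
  rw [he]
  exact (contDiffOn_const.mul (hn.mul h1.neg)).add (contDiffOn_const.mul (hn.mul h0))

/-- Smoothness is checked in the ambient space, off the axis of the chart, so that it can be pulled
back along the smooth inclusion of the sphere. -/
theorem exists_contDiffOn_coeff {l : ℕ} {s : ℤ} (hs : s.natAbs ≤ l) (R : SO3) (i : ℕ) :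
    ∃ g : E3 → ℂ, ContDiffOn ℝ ∞ g (offAxis R) ∧
      ∀ p ∈ chart R, (spinPoly l s R p).coeff i = g p.1 := by
  obtain ⟨w, hw⟩ := exists_coeff_eq_sum_eval (2 * l) i
  set T : E3 → Fin 3 → ℂ := fun q j =>
    ((refExt R q ⨯₃ q.ofLp) j : ℂ) + Complex.I * (refExt R q j : ℂ) with hT
  set V : E3 → Fin 3 → ℂ := fun q => if 0 ≤ s then -T q else star (T q) with hV
  have hx : ∀ j : Fin 3, ContDiffOn ℝ ∞ (fun q : E3 => ((q.ofLp j : ℝ) : ℂ)) (offAxis R) :=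
    fun j => Complex.ofRealCLM.contDiff.comp_contDiffOn (by fun_prop)
  have hr : ∀ j : Fin 3, ContDiffOn ℝ ∞ (fun q : E3 => ((refExt R q j : ℝ) : ℂ)) (offAxis R) :=
    fun j => Complex.ofRealCLM.contDiff.comp_contDiffOn (contDiffOn_refExt R j)
  have hTj : ∀ j, ContDiffOn ℝ ∞ (fun q => T q j) (offAxis R) := fun j => by
    simp only [hT]
    refine ContDiffOn.add ?_ (contDiffOn_const.mul (hr j))
    fin_cases j <;> simp only [cross_apply] <;> simp
    · exact ((hr 1).mul (hx 2)).sub ((hr 2).mul (hx 1))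
    · exact ((hr 2).mul (hx 0)).sub ((hr 0).mul (hx 2))
    · exact ((hr 0).mul (hx 1)).sub ((hr 1).mul (hx 0))
  have hVj : ∀ j, ContDiffOn ℝ ∞ (fun q => V q j) (offAxis R) := fun j => by
    simp only [hV]
    split_ifs
    · exact (hTj j).neg
    · exact Complex.conjCLE.contDiff.comp_contDiffOn (hTj j)
  refine ⟨fun q => ∑ j ∈ Finset.range (2 * l + 1), w j *
    ((nullVec (j : ℂ) ⬝ᵥ fun k => ((q.ofLp k : ℝ) : ℂ)) ^ (l - s.natAbs) *
      (nullVec (j : ℂ) ⬝ᵥ V q) ^ s.natAbs), ?_, fun p hp => ?_⟩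
  · refine ContDiffOn.sum fun j _ => contDiffOn_const.mul (ContDiffOn.mul ?_ ?_)
    · refine ContDiffOn.pow ?_ _
      simp only [dotProduct]
      exact ContDiffOn.sum fun k _ => contDiffOn_const.mul (hx k)
    · refine ContDiffOn.pow ?_ _
      simp only [dotProduct]
      exact ContDiffOn.sum fun k _ => contDiffOn_const.mul (hVj k)
  · rw [hw _ (natDegree_spinPoly_le hs R p)]
    refine Finset.sum_congr rfl fun j _ => ?_
    have h1 : tang R p = T p.1 := by
      ext k; simp only [tang, hT, ref_eq_refExt hp]
    have h2 : spinVec s R p = V p.1 := by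
      simp only [spinVec, hV, h1]
    simp only [spinPoly, Polynomial.eval_mul, Polynomial.eval_pow, eval_nullPoly, h2]
    rfl

theorem isOpen_chart (R : SO3) : IsOpen (chart R) := by
  have : chart R = rot R⁻¹ ⁻¹' ({north, south}ᶜ : Set S2) := by
    ext p; exact mem_chart_iff
  rw [this]
  exact (Set.toFinite _).isClosed.isOpen_compl.preimage (continuous_rot _)

theorem continuousOn_coeff_spinPoly {l : ℕ} {s : ℤ} (hs : s.natAbs ≤ l) (R : SO3) (i : ℕ) :
    ContinuousOn (fun p => (spinPoly l s R p).coeff i) (chart R) := by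
  obtain ⟨g, hg, hgp⟩ := exists_contDiffOn_coeff hs R i
  exact (hg.continuousOn.comp continuous_subtype_val.continuousOn
    fun p hp => coe_mem_offAxis hp).congr hgp

/-! ### The surface measure -/

/-- A rotation as a linear isometry of `ℝ³`. -/
def rotIsometry (R : SO3) : E3 ≃ₗᵢ[ℝ] E3 :=
  LinearIsometry.toLinearIsometryEquiv
    { toLinearMap := Matrix.toEuclideanLin R.1
      norm_map' := fun x => by
        have h := mulVec_dot_mulVec R x.ofLp x.ofLp
        simp only [EuclideanSpace.norm_eq, Real.norm_eq_abs, sq_abs]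
        simp only [dotProduct, ← sq] at h
        congr 1 } rfl

theorem rotIsometry_apply (R : SO3) (p : S2) : rotIsometry R p.1 = (rot R p).1 := rfl

/-- The measure of a set is a multiple of the volume of the cone over it, and volume is invariant
under linear isometries. -/
theorem measurePreserving_rot (R : SO3) : MeasurePreserving (rot R) dS dS := by
  have hm := (continuous_rot R).measurable
  refine ⟨hm, ?_⟩
  ext t ht
  rw [Measure.map_apply hm ht, Measure.toSphere_apply' _ ht, Measure.toSphere_apply' _ (hm ht)]
  congr 1
  conv_rhs => rw [← (LinearIsometryEquiv.measurePreserving (rotIsometry R)).measure_preimage_emb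
    (rotIsometry R).toHomeomorph.measurableEmbedding]
  congr 1
  ext x
  simp only [Set.mem_preimage, Set.mem_smul, Set.mem_image]
  constructor
  · rintro ⟨a, ha, _, ⟨p, hp, rfl⟩, rfl⟩
    exact ⟨a, ha, _, ⟨rot R p, hp, rfl⟩, by rw [map_smul, rotIsometry_apply]⟩
  · rintro ⟨a, ha, _, ⟨p, hp, rfl⟩, h⟩
    refine ⟨a, ha, _, ⟨rot R⁻¹ p, by rwa [rot_rot_inv], rfl⟩, ?_⟩
    apply (rotIsometry R).injective
    rw [← h, map_smul, rotIsometry_apply, rot_rot_inv]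

theorem dS_singleton (p : S2) : dS {p} = 0 := by
  rw [Measure.toSphere_apply' _ (measurableSet_singleton p)]
  refine mul_eq_zero_of_right _ (measure_mono_null ?_ (Measure.addHaar_submodule volume
    -- The cone over a point lies in a line, a proper subspace and hence null.
    (Submodule.span ℝ {p.1}) fun h => ?_))
  · rintro _ ⟨a, _, _, ⟨q, rfl, rfl⟩, rfl⟩
    exact Submodule.smul_mem _ _ (Submodule.mem_span_singleton_self _)
  · have h1 := finrank_span_singleton (K := ℝ) (v := p.1) (by
      intro h0
      have := sum_sq_of_mem p
      simp [h0] at this)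
    rw [h, finrank_top] at h1
    simp at h1

theorem ae_mem_chart (R : SO3) : ∀ᵐ p ∂dS, p ∈ chart R := by
  have h : (chart R)ᶜ ⊆ {rot R north} ∪ {rot R south} := by
    intro p hp
    have h1 : rot R⁻¹ p ∈ ({north, south} : Set S2) := by
      by_contra h
      exact hp (mem_chart_iff.2 h)
    rcases h1 with h1 | h1
    · left; rw [← rot_rot_inv R p, h1]; rfl
    · right; rw [← rot_rot_inv R p, h1]; rfl
  exact measure_mono_null h (measure_union_null (dS_singleton _) (dS_singleton _))

theorem dS_real_univ : (dS).real Set.univ = 4 * Real.pi := by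
  rw [Measure.toSphere_real_apply_univ, measureReal_def, EuclideanSpace.volume_ball_fin_three]
  rw [ENNReal.ofReal_one, one_pow, one_mul, ENNReal.toReal_ofReal (by positivity)]
  simp
  ring

theorem aestronglyMeasurable_of_continuousOn_chart {R : SO3} {f : S2 → ℂ}
    (hf : ContinuousOn f (chart R)) : AEStronglyMeasurable f dS := by
  have h := hf.aestronglyMeasurable (μ := dS) (isOpen_chart R).measurableSet
  rwa [Measure.restrict_eq_self_of_ae_mem (ae_mem_chart R)] at h

/-! ### Transition laws -/

theorem conj_exp_I_mul_mul (s : ℤ) (ψ : ℝ) :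
    conj (Complex.exp (Complex.I * s * ψ)) = Complex.exp (-(Complex.I * s * ψ)) := by
  rw [← Complex.exp_conj]
  simp

theorem exp_mul_conj_exp (s : ℤ) (ψ : ℝ) :
    Complex.exp (Complex.I * s * ψ) * conj (Complex.exp (Complex.I * s * ψ)) = 1 := by
  rw [conj_exp_I_mul_mul, ← Complex.exp_add, add_neg_cancel, Complex.exp_zero]

theorem norm_exp_I_mul_mul (s : ℤ) (ψ : ℝ) : ‖Complex.exp (Complex.I * s * ψ)‖ = 1 := by
  rw [show Complex.I * s * ψ = ((s * ψ : ℝ) : ℂ) * Complex.I by push_cast; ring,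
    Complex.norm_exp_ofReal_mul_I]

/-- No chart condition is imposed: at a pole of a chart, `ref` still takes a default unit tangent
value. This is used at the north pole. For `s < 0` the conjugated phase raised to the power `|s| =
-s` is again `e^{isψ}`. -/
theorem spinPoly_transition (l : ℕ) (s : ℤ) (R₁ R₂ : SO3) (p : S2) :
    spinPoly l s R₂ p =
      Polynomial.C (Complex.exp (Complex.I * s * angle p (ref R₁ p) (ref R₂ p))) *
        spinPoly l s R₁ p := by
  have h : ∃ c : ℂ, spinVec s R₂ p = c • spinVec s R₁ p ∧
      c ^ s.natAbs = Complex.exp (Complex.I * s * angle p (ref R₁ p) (ref R₂ p)) := by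
    set ψ := angle p (ref R₁ p) (ref R₂ p) with hψ
    unfold spinVec
    split_ifs with h0
    · refine ⟨Complex.exp (Complex.I * ψ), by rw [tang_eq_smul R₁ R₂, smul_neg], ?_⟩
      rw [← Complex.exp_nat_mul]
      have : ((s.natAbs : ℕ) : ℂ) = (s : ℂ) := by
        rw [← Int.cast_natCast, Int.natAbs_of_nonneg h0]
      rw [this]
      ring_nf
    · refine ⟨conj (Complex.exp (Complex.I * ψ)), by rw [tang_eq_smul R₁ R₂, star_smul]; rfl, ?_⟩
      rw [← Complex.exp_conj, ← Complex.exp_nat_mul]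
      have : ((s.natAbs : ℕ) : ℂ) = -(s : ℂ) := by
        rw [← Int.cast_natCast, (by omega : (s.natAbs : ℤ) = -s), Int.cast_neg]
      rw [this]
      simp
      ring_nf
  obtain ⟨c, hc, hc'⟩ := h
  rw [spinPoly, spinPoly, hc, nullPoly_smul, mul_pow, ← Polynomial.C_pow, hc']
  ring

theorem coeff_mul_conj_coeff_frame (l : ℕ) (s : ℤ) (R₁ R₂ : SO3) (p : S2) (i j : ℕ) :
    (spinPoly l s R₂ p).coeff i * conj ((spinPoly l s R₂ p).coeff j) =
      (spinPoly l s R₁ p).coeff i * conj ((spinPoly l s R₁ p).coeff j) := by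
  rw [spinPoly_transition l s R₁ R₂, Polynomial.coeff_C_mul, Polynomial.coeff_C_mul, map_mul,
    mul_mul_mul_comm, exp_mul_conj_exp, one_mul]

theorem norm_coeff_frame (l : ℕ) (s : ℤ) (R₁ R₂ : SO3) (p : S2) (i : ℕ) :
    ‖(spinPoly l s R₂ p).coeff i‖ = ‖(spinPoly l s R₁ p).coeff i‖ := by
  rw [spinPoly_transition l s R₁ R₂, Polynomial.coeff_C_mul, norm_mul, norm_exp_I_mul_mul, one_mul]

/-! ### Integrability -/

theorem norm_coeff_sq_le {l : ℕ} {s : ℤ} (hs : s.natAbs ≤ l) (R : SO3) {p : S2}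
    (hp : p ∈ chart 1) {i : ℕ} (hi : i ≤ 2 * l) :
    ‖(spinPoly l s R p).coeff i‖ ^ 2 ≤ (2 * l).choose i := by
  rw [norm_coeff_frame l s 1 R]
  have h1 := Finset.single_le_sum (s := Finset.range (2 * l + 1))
    (f := fun i => ‖(spinPoly l s 1 p).coeff i‖ ^ 2 / ((2 * l).choose i : ℝ))
    (fun i _ => by positivity) (Finset.mem_range.2 (Nat.lt_succ_of_le hi))
  rw [sum_sq_norm_coeff_spinPoly hs hp] at h1
  have h2 : (1 : ℝ) / (2 * l).choose (l - s).toNat ≤ 1 := by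
    rw [div_le_one (by exact_mod_cast Nat.choose_pos (by omega))]
    exact_mod_cast Nat.choose_pos (by omega)
  have h3 : (0 : ℝ) < (2 * l).choose i := by exact_mod_cast Nat.choose_pos hi
  have h4 := h1.trans h2
  rwa [div_le_one h3] at h4

theorem memLp_coeff_spinPoly {l : ℕ} {s : ℤ} (hs : s.natAbs ≤ l) (R : SO3) {i : ℕ}
    (hi : i ≤ 2 * l) : MemLp (fun p => (spinPoly l s R p).coeff i) 2 dS := by
  refine MemLp.of_bound (aestronglyMeasurable_of_continuousOn_chart
    (continuousOn_coeff_spinPoly hs R i)) (Real.sqrt ((2 * l).choose i)) ?_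
  filter_upwards [ae_mem_chart 1] with p hp
  exact Real.le_sqrt_of_sq_le (norm_coeff_sq_le hs R hp hi)

theorem integrable_mul_conj {f g : S2 → ℂ} (hf : MemLp f 2 dS) (hg : MemLp g 2 dS) :
    Integrable (fun p => f p * conj (g p)) dS :=
  hf.integrable_mul hg.star

/-! ### Orthogonality -/

/-- The Gram matrix of the coefficients of the generating polynomial. -/
def gram (l : ℕ) (s : ℤ) (i j : ℕ) : ℂ :=
  ∫ p, (spinPoly l s 1 p).coeff i * conj ((spinPoly l s 1 p).coeff j) ∂dS

theorem spinVec_rot (s : ℤ) (Q : SO3) (p : S2) :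
    spinVec s Q (rot Q p) = cmat Q *ᵥ spinVec s 1 p := by
  unfold spinVec
  rw [tang_rot]
  split_ifs
  · rw [Matrix.mulVec_neg]
  · ext i
    simp [Matrix.mulVec, dotProduct]

/-- The phases cancel in the product, so after the change of variables `p ↦ Qp` the frame of `Q` may
be used at `Qp`. It is the image of the standard frame at `p`, hence `spinPoly` there is a
substitution in the one at `p`. -/
theorem gram_eq_integral_rot {l : ℕ} {s : ℤ} (hs : s.natAbs ≤ l) (Q : SO3) (i j : ℕ) :
    gram l s i j = ∫ p, (spinPoly l s Q (rot Q p)).coeff i *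
      conj ((spinPoly l s Q (rot Q p)).coeff j) ∂dS := by
  have hmp := measurePreserving_rot Q
  have hm : AEStronglyMeasurable (fun p => (spinPoly l s 1 p).coeff i *
      conj ((spinPoly l s 1 p).coeff j)) dS := aestronglyMeasurable_of_continuousOn_chart (R := 1)
    ((continuousOn_coeff_spinPoly hs 1 i).mul (continuousOn_coeff_spinPoly hs 1 j).star)
  have h := integral_map (μ := dS) hmp.measurable.aemeasurable (by rwa [hmp.map_eq])
  rw [hmp.map_eq] at h
  rw [gram, h]
  simp only [coeff_mul_conj_coeff_frame l s 1 Q]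

/-! ### Rotations acting on the generating polynomial -/

/-- Rotation by the angle `α` about the third axis. -/
def rotZ (α : ℝ) : SO3 :=
  ⟨!![Real.cos α, -Real.sin α, 0; Real.sin α, Real.cos α, 0; 0, 0, 1], by
    have h := Real.sin_sq_add_cos_sq α
    rw [Matrix.mem_specialOrthogonalGroup_iff, Matrix.mem_orthogonalGroup_iff]
    constructor
    · ext i j
      fin_cases i <;> fin_cases j <;>
        simp [Matrix.mul_apply, Fin.sum_univ_three] <;> nlinarith
    · rw [Matrix.det_fin_three]
      simp
      nlinarith⟩

/-- Rotation about the second axis by the angle with half-tangent `τ`. -/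
def rotY (τ : ℝ) : SO3 :=
  ⟨!![(1 - τ ^ 2) / (1 + τ ^ 2), 0, 2 * τ / (1 + τ ^ 2); 0, 1, 0;
      -(2 * τ / (1 + τ ^ 2)), 0, (1 - τ ^ 2) / (1 + τ ^ 2)], by
    have h : 1 + τ ^ 2 ≠ 0 := by positivity
    have h1 : (1 - τ ^ 2) / (1 + τ ^ 2) * ((1 - τ ^ 2) / (1 + τ ^ 2)) +
        2 * τ / (1 + τ ^ 2) * (2 * τ / (1 + τ ^ 2)) = 1 := by
      field_simp
      ring
    set a := (1 - τ ^ 2) / (1 + τ ^ 2)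
    set b := 2 * τ / (1 + τ ^ 2)
    rw [Matrix.mem_specialOrthogonalGroup_iff, Matrix.mem_orthogonalGroup_iff]
    constructor
    · ext i j
      fin_cases i <;> fin_cases j <;>
        simp [Matrix.mul_apply, Fin.sum_univ_three] <;> nlinarith
    · rw [Matrix.det_fin_three]
      simp
      nlinarith⟩

theorem nullPoly_rotZ (α : ℝ) (v : Fin 3 → ℂ) : nullPoly (cmat (rotZ α) *ᵥ v) =
    Polynomial.C (Complex.exp (-(Complex.I * α))) *
      (nullPoly v).comp (Polynomial.C (Complex.exp (Complex.I * α)) * Polynomial.X) := by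
  apply Polynomial.funext
  intro z
  have hw : Complex.exp (-(Complex.I * α)) * Complex.exp (Complex.I * α) = 1 := by
    rw [← Complex.exp_add]; simp
  have h1 : Complex.exp (Complex.I * α) = Complex.cos α + Complex.I * Complex.sin α := by
    rw [mul_comm, Complex.exp_mul_I]; ring
  have h2 : Complex.exp (-(Complex.I * α)) = Complex.cos α - Complex.I * Complex.sin α := by
    rw [mul_comm, ← neg_mul, Complex.exp_mul_I, Complex.cos_neg, Complex.sin_neg]
    ring
  simp [nullPoly, rotZ, Matrix.mulVec, dotProduct, Fin.sum_univ_three]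
  set w := Complex.exp (Complex.I * α)
  set w' := Complex.exp (-(Complex.I * α))
  set x := Complex.cos α
  set y := Complex.sin α
  linear_combination (-(v 0 + Complex.I * v 1) / 2 * z ^ 2) * h1 +
    ((v 0 - Complex.I * v 1) / 2) * h2 -
    ((v 0 + Complex.I * v 1) / 2 * w * z ^ 2 + v 2 * z) * hw +
    y * v 1 / 2 * (1 - z ^ 2) * Complex.I_sq

theorem spinPoly_rotZ {l : ℕ} {s : ℤ} (hs : s.natAbs ≤ l) (α : ℝ) (p : S2) (i : ℕ) :
    (spinPoly l s (rotZ α) (rot (rotZ α) p)).coeff i =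
      Complex.exp (Complex.I * ((i - l : ℤ) : ℂ) * α) * (spinPoly l s 1 p).coeff i := by
  have h : spinPoly l s (rotZ α) (rot (rotZ α) p) =
      Polynomial.C (Complex.exp (-(Complex.I * α)) ^ l) *
      (spinPoly l s 1 p).comp (Polynomial.C (Complex.exp (Complex.I * α)) * Polynomial.X) := by
    rw [spinPoly, spinPoly, cvec_rot, spinVec_rot, nullPoly_rotZ, nullPoly_rotZ,
      Polynomial.mul_comp, Polynomial.pow_comp, Polynomial.pow_comp, mul_pow, mul_pow,
      ← Polynomial.C_pow, ← Polynomial.C_pow,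
      show Complex.exp (-(Complex.I * α)) ^ l = Complex.exp (-(Complex.I * α)) ^ (l - s.natAbs) *
        Complex.exp (-(Complex.I * α)) ^ s.natAbs by rw [← pow_add]; congr 1; omega,
      Polynomial.C_mul]
    ring
  rw [h, Polynomial.coeff_C_mul, Polynomial.comp_C_mul_X_coeff, ← exp_neg_pow_mul_exp_pow]
  ring

theorem gram_zero_right {l : ℕ} {s : ℤ} (hs : s.natAbs ≤ l) {i : ℕ} (hi : i ≠ 0) :
    gram l s i 0 = 0 := by
  -- The angle `π / i` makes the relative phase of the coefficients `i` and `0` equal to `-1`.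
  have h := gram_eq_integral_rot hs (rotZ (Real.pi / i)) i 0
  have hphase : Complex.exp (Complex.I * ((i - l : ℤ) : ℂ) * (Real.pi / i : ℝ)) *
      conj (Complex.exp (Complex.I * (((0 : ℕ) - l : ℤ) : ℂ) * (Real.pi / i : ℝ))) = -1 := by
    rw [conj_exp_I_mul_mul, ← Complex.exp_add, ← Complex.exp_pi_mul_I]
    congr 1
    have : (i : ℂ) ≠ 0 := by exact_mod_cast hi
    push_cast
    field_simp
    ring
  have h2 : gram l s i 0 = -gram l s i 0 := by
    conv_lhs => rw [h]
    rw [gram, ← integral_neg]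
    refine integral_congr_ae (Eventually.of_forall fun p => ?_)
    simp only [spinPoly_rotZ hs, map_mul]
    rw [mul_mul_mul_comm, hphase]
    ring
  exact self_eq_neg.1 h2

/-- A rotation acts on quadratic forms in `z` through a Möbius map. The half-tangent parameter keeps
it rational, and the map sends `z = τ` to `0`. -/
theorem eval_nullPoly_rotY (τ : ℝ) (v : Fin 3 → ℂ) {z : ℂ} (hz : 1 + τ * z ≠ 0) :
    (nullPoly (cmat (rotY τ) *ᵥ v)).eval z =
      (1 + τ * z) ^ 2 / (1 + τ ^ 2) * (nullPoly v).eval ((z - τ) / (1 + τ * z)) := by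
  have h : (1 + (τ : ℂ) ^ 2) ≠ 0 := by exact_mod_cast (by positivity : 1 + τ ^ 2 ≠ 0)
  simp [nullPoly, rotY, Matrix.mulVec, dotProduct, Fin.sum_univ_three]
  field_simp
  ring

theorem eval_spinPoly_rotY {l : ℕ} {s : ℤ} (hs : s.natAbs ≤ l) (τ : ℝ) (p : S2) {z : ℂ}
    (hz : 1 + τ * z ≠ 0) :
    (spinPoly l s (rotY τ) (rot (rotY τ) p)).eval z =
      ((1 + τ * z) ^ 2 / (1 + τ ^ 2)) ^ l *
        (spinPoly l s 1 p).eval ((z - τ) / (1 + τ * z)) := by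
  rw [spinPoly, spinPoly, cvec_rot, spinVec_rot, Polynomial.eval_mul, Polynomial.eval_mul,
    Polynomial.eval_pow, Polynomial.eval_pow, Polynomial.eval_pow, Polynomial.eval_pow,
    eval_nullPoly_rotY τ _ hz, eval_nullPoly_rotY τ _ hz, mul_pow, mul_pow]
  nth_rewrite 3 [show l = l - s.natAbs + s.natAbs by omega]
  rw [pow_add]
  ring

theorem sum_gram_eq_integral {l : ℕ} {s : ℤ} (hs : s.natAbs ≤ l) (Q : SO3) (z w : ℂ) :
    ∑ i ∈ Finset.range (2 * l + 1), ∑ j ∈ Finset.range (2 * l + 1),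
      gram l s i j * z ^ i * conj w ^ j =
    ∫ p, (spinPoly l s Q (rot Q p)).eval z * conj ((spinPoly l s Q (rot Q p)).eval w) ∂dS := by
  have hint : ∀ i ∈ Finset.range (2 * l + 1), ∀ j ∈ Finset.range (2 * l + 1),
      Integrable (fun p => (spinPoly l s Q (rot Q p)).coeff i *
        conj ((spinPoly l s Q (rot Q p)).coeff j) * (z ^ i * conj w ^ j)) dS := fun i hi j hj =>
    ((measurePreserving_rot Q).integrable_comp_of_integrable (integrable_mul_conj
      (memLp_coeff_spinPoly hs Q (Nat.lt_succ_iff.1 (Finset.mem_range.1 hi)))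
      (memLp_coeff_spinPoly hs Q (Nat.lt_succ_iff.1 (Finset.mem_range.1 hj))))).mul_const _
  have he : ∀ p, (spinPoly l s Q (rot Q p)).eval z * conj ((spinPoly l s Q (rot Q p)).eval w) =
      ∑ i ∈ Finset.range (2 * l + 1), ∑ j ∈ Finset.range (2 * l + 1),
        (spinPoly l s Q (rot Q p)).coeff i *
        conj ((spinPoly l s Q (rot Q p)).coeff j) * (z ^ i * conj w ^ j) := fun p => by
    have hd : (spinPoly l s Q (rot Q p)).natDegree < 2 * l + 1 :=
      Nat.lt_succ_of_le (natDegree_spinPoly_le hs _ _)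
    rw [Polynomial.eval_eq_sum_range' hd, Polynomial.eval_eq_sum_range' hd, map_sum,
      Finset.sum_mul_sum]
    refine Finset.sum_congr rfl fun i _ => Finset.sum_congr rfl fun j _ => ?_
    rw [map_mul, map_pow]
    ring
  simp only [he]
  rw [integral_finsetSum _ fun i hi => integrable_finsetSum _ (hint i hi)]
  refine Finset.sum_congr rfl fun i hi => ?_
  rw [integral_finsetSum _ (hint i hi)]
  refine Finset.sum_congr rfl fun j hj => ?_
  rw [gram_eq_integral_rot hs Q, integral_mul_const]
  ring

/-- The rotation with half-tangent `y` moves the second argument `y` of the generating function `∑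
G_ij x^i y^j` to `0`, where only `G_00` survives. The Möbius factors multiply to `(1 + xy)^{2l}`.
Natural numbers `x`, `y` suffice to identify polynomial coefficients and keep `1 + xy` nonzero. -/
theorem gram_eq {l : ℕ} {s : ℤ} (hs : s.natAbs ≤ l) {i j : ℕ} (hi : i ≤ 2 * l) (hj : j ≤ 2 * l) :
    gram l s i j = if i = j then (2 * l).choose i * gram l s 0 0 else 0 := by
  have key := coeff_eq_zero_of_sum_pow₂ (K := ℂ) (N := 2 * l + 1)
    (c := fun i j => gram l s i j - (if i = j then ((2 * l).choose i : ℂ) else 0) * gram l s 0 0)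
    (fun x y => ?_) (Nat.lt_succ_of_le hi) (Nat.lt_succ_of_le hj)
  · rw [sub_eq_zero.1 key]
    split_ifs <;> simp
  have hxy : (1 + ((y : ℝ) : ℂ) * x) ≠ 0 := by
    exact_mod_cast (by positivity : (1 + (y : ℝ) * x) ≠ 0)
  have hyy : (1 + ((y : ℝ) : ℂ) * y) ≠ 0 := by
    exact_mod_cast (by positivity : (1 + (y : ℝ) * y) ≠ 0)
  have h1 := sum_gram_eq_integral hs (rotY y) x y
  simp only [eval_spinPoly_rotY hs (y : ℝ) _ hxy, eval_spinPoly_rotY hs (y : ℝ) _ hyy] at h1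
  set z' : ℂ := (x - ((y : ℝ) : ℂ)) / (1 + ((y : ℝ) : ℂ) * x)
  have h2 := sum_gram_eq_integral hs 1 z' 0
  have h3 : ∑ i ∈ Finset.range (2 * l + 1), ∑ j ∈ Finset.range (2 * l + 1),
      gram l s i j * z' ^ i * conj (0 : ℂ) ^ j = gram l s 0 0 := by
    rw [Finset.sum_eq_single 0, Finset.sum_eq_single 0]
    · simp
    · intro j _ hj; simp [hj]
    · simp
    · intro i _ hi
      refine Finset.sum_eq_zero fun j _ => ?_
      rcases eq_or_ne j 0 with rfl | hj
      · rw [gram_zero_right hs hi]; simp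
      · simp [hj]
    · simp
  have h4 : ∑ i ∈ Finset.range (2 * l + 1), ∑ j ∈ Finset.range (2 * l + 1),
      gram l s i j * (x : ℂ) ^ i * (y : ℂ) ^ j = (1 + (y : ℂ) * x) ^ (2 * l) * gram l s 0 0 := by
    rw [Complex.conj_natCast] at h1
    rw [h1, ← h3, h2, ← integral_const_mul]
    refine integral_congr_ae (Eventually.of_forall fun p => ?_)
    have h5 : (1 + (y : ℂ) ^ 2) ≠ 0 := by
      exact_mod_cast (by positivity : (1 + (y : ℝ) ^ 2) ≠ 0)
    have h6 : ((1 + (y : ℂ) * y) ^ 2 / (1 + (y : ℂ) ^ 2)) ^ l = (1 + (y : ℂ) ^ 2) ^ l := by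
      congr 1
      field_simp
    simp only [rot_one, map_mul, Complex.ofReal_natCast, sub_self, zero_div, map_pow, map_div₀,
      map_add, map_one, Complex.conj_natCast]
    rw [h6, div_pow, pow_mul]
    field_simp
  have h7 : ∀ i j : ℕ, (gram l s i j - (if i = j then ((2 * l).choose i : ℂ) else 0) *
      gram l s 0 0) * (x : ℂ) ^ i * (y : ℂ) ^ j = gram l s i j * (x : ℂ) ^ i * (y : ℂ) ^ j -
      gram l s 0 0 * ((if i = j then ((2 * l).choose i : ℂ) else 0) * (x : ℂ) ^ i * (y : ℂ) ^ j) :=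
    fun i j => by ring
  simp only [h7, Finset.sum_sub_distrib, ← Finset.mul_sum]
  rw [h4, sum_delta_choose]
  ring

/-- Each of the `2l + 1` terms `G_ii / C(2l, i)` equals `G_00`, while their sum is the integral of a
constant over a sphere of area `4π`. -/
theorem gram_zero_zero {l : ℕ} {s : ℤ} (hs : s.natAbs ≤ l) :
    gram l s 0 0 =
      ((4 * Real.pi / ((2 * l + 1) * (2 * l).choose (l - s).toNat) : ℝ) : ℂ) := by
  have h1 : ∀ᵐ p ∂dS, ∑ i ∈ Finset.range (2 * l + 1), (spinPoly l s 1 p).coeff i *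
      conj ((spinPoly l s 1 p).coeff i) / ((2 * l).choose i : ℂ) =
      ((1 / (2 * l).choose (l - s).toNat : ℝ) : ℂ) := by
    filter_upwards [ae_mem_chart 1] with p hp
    rw [← sum_sq_norm_coeff_spinPoly hs hp]
    push_cast
    simp only [Complex.mul_conj']
  have h2 := integral_congr_ae h1
  rw [integral_const, dS_real_univ, integral_finsetSum _ fun i hi =>
    (integrable_mul_conj (memLp_coeff_spinPoly hs 1 (Nat.lt_succ_iff.1 (Finset.mem_range.1 hi)))
      (memLp_coeff_spinPoly hs 1 (Nat.lt_succ_iff.1 (Finset.mem_range.1 hi)))).div_const _] at h2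
  have h3 : ∀ i ∈ Finset.range (2 * l + 1), ∫ p, (spinPoly l s 1 p).coeff i *
      conj ((spinPoly l s 1 p).coeff i) / ((2 * l).choose i : ℂ) ∂dS = gram l s 0 0 := by
    intro i hi
    have hi' := Nat.lt_succ_iff.1 (Finset.mem_range.1 hi)
    have h0 : ((2 * l).choose i : ℂ) ≠ 0 := by exact_mod_cast (Nat.choose_pos hi').ne'
    rw [integral_div]
    change gram l s i i / _ = _
    rw [gram_eq hs hi' hi', if_pos rfl, mul_div_cancel_left₀ _ h0]
  rw [Finset.sum_congr rfl h3, Finset.sum_const, Finset.card_range, nsmul_eq_mul] at h2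
  have h4 : ((2 * l + 1 : ℕ) : ℂ) ≠ 0 := by exact_mod_cast Nat.succ_ne_zero (2 * l)
  apply mul_left_cancel₀ h4
  rw [h2, Complex.real_smul]
  have h5 : ((2 * l).choose (l - s).toNat : ℂ) ≠ 0 := by
    exact_mod_cast (Nat.choose_pos (by omega)).ne'
  push_cast at h4 ⊢
  field_simp

/-! ### The spin harmonics form an orthonormal basis of `H_{ls}` -/

theorem exists_index {l : ℕ} {m : ℤ} (h1 : -(l : ℤ) ≤ m) (h2 : m ≤ l) :
    ∃ i : ℕ, i ≤ 2 * l ∧ m = (i : ℤ) - l :=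
  ⟨(l + m).toNat, by omega, by omega⟩

theorem sY_transition {l : ℕ} {s m : ℤ} (hs : s.natAbs ≤ l) (h1 : -(l : ℤ) ≤ m) (h2 : m ≤ l) :
    IsSpin s (sY l s m) := by
  obtain ⟨i, hi, rfl⟩ := exists_index h1 h2
  rintro R₁ R₂ p ⟨hp₁, hp₂⟩
  rw [sY_eq_coeff hs R₁ hp₁, sY_eq_coeff hs R₂ hp₂, spinPoly_transition l s R₁ R₂,
    Polynomial.coeff_C_mul]
  ring

theorem sY_mem_spinL2 {l : ℕ} {s m : ℤ} (hs : s.natAbs ≤ l) (h1 : -(l : ℤ) ≤ m) (h2 : m ≤ l) :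
    sY l s m ∈ spinL2 s := by
  refine ⟨sY_transition hs h1 h2, fun R => ?_⟩
  obtain ⟨i, hi, rfl⟩ := exists_index h1 h2
  refine ((memLp_coeff_spinPoly hs R hi).const_mul (spinCoeff l s i : ℂ)).ae_eq ?_
  filter_upwards [ae_mem_chart R] with p hp
  exact (sY_eq_coeff hs R hp).symm

theorem H_le_spinL2 {l : ℕ} {s : ℤ} (hs : s.natAbs ≤ l) : H l s ≤ spinL2 s :=
  Submodule.span_le.2 fun _ ⟨_, h1, h2, h⟩ => h ▸ sY_mem_spinL2 hs h1 h2

theorem spinInner_sY {l : ℕ} {s m m' : ℤ} (hs : s.natAbs ≤ l) (h1 : -(l : ℤ) ≤ m) (h2 : m ≤ l)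
    (h1' : -(l : ℤ) ≤ m') (h2' : m' ≤ l) :
    spinInner (sY l s m) (sY l s m') = if m = m' then 1 else 0 := by
  obtain ⟨i, hi, rfl⟩ := exists_index h1 h2
  obtain ⟨j, hj, rfl⟩ := exists_index h1' h2'
  have h : spinInner (sY l s ((i : ℤ) - l)) (sY l s ((j : ℤ) - l)) =
      spinCoeff l s i * spinCoeff l s j * gram l s i j := by
    rw [spinInner, gram, ← integral_const_mul]
    refine integral_congr_ae ?_
    filter_upwards [ae_mem_chart 1] with p hp
    rw [sY_eq_coeff hs 1 hp, sY_eq_coeff hs 1 hp, map_mul, Complex.conj_ofReal]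
    ring
  rw [h, gram_eq hs hi hj, gram_zero_zero hs]
  by_cases hij : i = j
  · subst hij
    rw [if_pos rfl, if_pos rfl]
    have h3 := spinCoeff_sq hs hi
    have h4 : ((2 * l).choose i : ℝ) ≠ 0 := by exact_mod_cast (Nat.choose_pos hi).ne'
    have h5 : ((2 * l).choose (l - s).toNat : ℝ) ≠ 0 := by
      exact_mod_cast (Nat.choose_pos (by omega)).ne'
    have h6 := Real.pi_ne_zero
    have h7 : (2 * (l : ℝ) + 1) ≠ 0 := by positivity
    have h8 : spinCoeff l s i * spinCoeff l s i * ((2 * l).choose i *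
        (4 * Real.pi / ((2 * l + 1) * (2 * l).choose (l - s).toNat))) = 1 := by
      rw [← sq, h3]
      field_simp
    exact_mod_cast h8
  · rw [if_neg hij, if_neg (by omega), mul_zero]

/-! ### The inner product -/

theorem integrable_spinL2 {s : ℤ} {f g : Family} (hf : f ∈ spinL2 s) (hg : g ∈ spinL2 s)
    (R : SO3) : Integrable (fun p => f R p * conj (g R p)) dS :=
  integrable_mul_conj (hf.2 R) (hg.2 R)

theorem spinInner_add_left {s : ℤ} {f g k : Family} (hf : f ∈ spinL2 s) (hg : g ∈ spinL2 s)
    (hk : k ∈ spinL2 s) : spinInner (f + g) k = spinInner f k + spinInner g k := by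
  rw [spinInner, spinInner, spinInner,
    ← integral_add (integrable_spinL2 hf hk 1) (integrable_spinL2 hg hk 1)]
  simp only [Pi.add_apply, add_mul]

theorem spinInner_smul_left (c : ℂ) (f k : Family) :
    spinInner (c • f) k = c * spinInner f k := by
  rw [spinInner, spinInner, ← integral_const_mul]
  simp only [Pi.smul_apply, smul_eq_mul, mul_assoc]

theorem spinInner_conj_symm (f g : Family) : conj (spinInner f g) = spinInner g f := by
  rw [spinInner, spinInner, ← integral_conj]
  refine integral_congr_ae (Eventually.of_forall fun p => ?_)
  simp only [map_mul, Complex.conj_conj]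
  ring

theorem spinInner_zero_left (k : Family) : spinInner 0 k = 0 := by
  simp [spinInner]

theorem spinInner_sum_left {s : ℤ} {ι : Type*} (S : Finset ι) {f : ι → Family} {k : Family}
    (hf : ∀ i ∈ S, f i ∈ spinL2 s) (hk : k ∈ spinL2 s) :
    spinInner (∑ i ∈ S, f i) k = ∑ i ∈ S, spinInner (f i) k := by
  classical
  induction S using Finset.induction_on with
  | empty => simp [spinInner_zero_left]
  | insert a S ha ih =>
    rw [Finset.sum_insert ha, Finset.sum_insert ha, spinInner_add_left (s := s)
      (hf a (Finset.mem_insert_self a S))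
      (Submodule.sum_mem _ fun i hi => hf i (Finset.mem_insert_of_mem hi)) hk,
      ih fun i hi => hf i (Finset.mem_insert_of_mem hi)]

theorem spinInner_eq_integral {s : ℤ} {f g : Family} (hf : IsSpin s f) (hg : IsSpin s g)
    (R : SO3) : spinInner f g = ∫ p, f R p * conj (g R p) ∂dS := by
  refine integral_congr_ae ?_
  filter_upwards [ae_mem_chart 1, ae_mem_chart R] with p hp hpR
  rw [hf 1 R p ⟨hp, hpR⟩, hg 1 R p ⟨hp, hpR⟩, map_mul, mul_mul_mul_comm, exp_mul_conj_exp, one_mul]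

/-! ### The projection kernel -/

theorem exists_contDiffOn_sY {l : ℕ} {s m : ℤ} (hs : s.natAbs ≤ l) (h1 : -(l : ℤ) ≤ m)
    (h2 : m ≤ l) (R : SO3) : ∃ g : E3 → ℂ, ContDiffOn ℝ ∞ g (offAxis R) ∧
      ∀ p ∈ chart R, sY l s m R p = g p.1 := by
  obtain ⟨i, hi, rfl⟩ := exists_index h1 h2
  obtain ⟨g, hg, hgp⟩ := exists_contDiffOn_coeff hs R i
  exact ⟨fun q => spinCoeff l s i * g q, contDiffOn_const.mul hg, fun p hp => by
    rw [sY_eq_coeff hs R hp, hgp p hp]⟩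

theorem contMDiffOn_Kls {l : ℕ} {s : ℤ} (hs : s.natAbs ≤ l) (R' R : SO3) :
    ContMDiffOn ((𝓡 2).prod (𝓡 2)) 𝓘(ℝ, ℂ) ∞
      (fun z : S2 × S2 => Kls l s R' R z.1 z.2) (chart R' ×ˢ chart R) := by
  have hg : ∀ R : SO3, ∀ m : ℤ, ∃ g : E3 → ℂ, m ∈ Finset.Icc (-(l : ℤ)) l →
      ContDiffOn ℝ ∞ g (offAxis R) ∧ ∀ p ∈ chart R, sY l s m R p = g p.1 := by
    intro R m
    by_cases hm : m ∈ Finset.Icc (-(l : ℤ)) l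
    · obtain ⟨g, hg⟩ := exists_contDiffOn_sY hs (Finset.mem_Icc.1 hm).1 (Finset.mem_Icc.1 hm).2 R
      exact ⟨g, fun _ => hg⟩
    · exact ⟨0, fun h => absurd h hm⟩
  choose g hg using hg
  have h1 : ContDiffOn ℝ ∞ (fun z : E3 × E3 => ∑ m ∈ Finset.Icc (-(l : ℤ)) l,
      g R' m z.1 * conj (g R m z.2)) (offAxis R' ×ˢ offAxis R) := by
    refine ContDiffOn.sum fun m hm => ContDiffOn.mul ?_ ?_
    · exact (hg R' m hm).1.comp contDiffOn_fst fun z hz => hz.1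
    · exact Complex.conjCLE.contDiff.comp_contDiffOn
        ((hg R m hm).1.comp contDiffOn_snd fun z hz => hz.2)
  have h2 : ContMDiff ((𝓡 2).prod (𝓡 2)) 𝓘(ℝ, E3 × E3) ∞
      (fun z : S2 × S2 => ((z.1 : E3), (z.2 : E3))) :=
    (contMDiff_coe_sphere.comp contMDiff_fst).prodMk_space
      (contMDiff_coe_sphere.comp contMDiff_snd)
  refine (h1.contMDiffOn.comp h2.contMDiffOn fun z hz =>
    ⟨coe_mem_offAxis hz.1, coe_mem_offAxis hz.2⟩).congr fun z hz => ?_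
  refine Finset.sum_congr rfl fun m hm => ?_
  rw [(hg R' m hm).2 _ hz.1, (hg R m hm).2 _ hz.2]

theorem Kls_transition {l : ℕ} {s : ℤ} (hs : s.natAbs ≤ l) (R' R R₁' R₁ : SO3) {x y : S2}
    (hx : x ∈ chart R₁' ∩ chart R') (hy : y ∈ chart R₁ ∩ chart R) :
    Kls l s R₁' R₁ x y = Complex.exp (Complex.I * s *
        (angle x (ref R' x) (ref R₁' x) - angle y (ref R y) (ref R₁ y))) * Kls l s R' R x y := by
  rw [Kls, Kls, Finset.mul_sum]
  refine Finset.sum_congr rfl fun m hm => ?_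
  have h := sY_transition hs (Finset.mem_Icc.1 hm).1 (Finset.mem_Icc.1 hm).2
  rw [h R' R₁' x hx.symm, h R R₁ y hy.symm, map_mul, conj_exp_I_mul_mul, mul_sub,
    sub_eq_add_neg, Complex.exp_add]
  ring

theorem isProjectionKernel_Kls {l : ℕ} {s : ℤ} (hs : s.natAbs ≤ l) :
    IsProjectionKernel s (H l s) (Kls l s) where
  le_spinL2 := H_le_spinL2 hs
  smooth := contMDiffOn_Kls hs
  transition R' R R₁' R₁ _ hx _ hy := Kls_transition hs R' R R₁' R₁ hx hy
  projection f hf := by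
    have hY : ∀ m ∈ Finset.Icc (-(l : ℤ)) l, sY l s m ∈ spinL2 s := fun m hm =>
      sY_mem_spinL2 hs (Finset.mem_Icc.1 hm).1 (Finset.mem_Icc.1 hm).2
    set h : Family := ∑ m ∈ Finset.Icc (-(l : ℤ)) l, spinInner f (sY l s m) • sY l s m with hh
    have hH : h ∈ H l s := Submodule.sum_mem _ fun m hm => Submodule.smul_mem _ _
      (Submodule.subset_span ⟨m, (Finset.mem_Icc.1 hm).1, (Finset.mem_Icc.1 hm).2, rfl⟩)
    have hfh : f - h ∈ spinL2 s := Submodule.sub_mem _ hf (H_le_spinL2 hs hH)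
    refine ⟨h, hH, fun g hg => ?_, fun R' R x _ => ?_⟩
    -- Conjugation moves `g` to the linear slot, which allows induction over the span.
    · rw [← spinInner_conj_symm, map_eq_zero]
      induction hg using Submodule.span_induction with
      | mem g hg =>
        obtain ⟨m, h1, h2, rfl⟩ := hg
        have hm : m ∈ Finset.Icc (-(l : ℤ)) l := Finset.mem_Icc.2 ⟨h1, h2⟩
        have e1 : spinInner h (sY l s m) = spinInner f (sY l s m) := by
          rw [hh, spinInner_sum_left (s := s) _ (fun m hm => Submodule.smul_mem _ _ (hY m hm))
            (hY m hm), Finset.sum_eq_single m]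
          · rw [spinInner_smul_left, spinInner_sY hs h1 h2 h1 h2, if_pos rfl, mul_one]
          · intro m' hm' hne
            rw [spinInner_smul_left, spinInner_sY hs (Finset.mem_Icc.1 hm').1
              (Finset.mem_Icc.1 hm').2 h1 h2, if_neg hne, mul_zero]
          · exact fun h => absurd hm h
        have e2 := spinInner_add_left hfh (H_le_spinL2 hs hH) (hY m hm)
        rw [sub_add_cancel, e1, right_eq_add] at e2
        rw [← spinInner_conj_symm, e2, map_zero]
      | zero => exact spinInner_zero_left _
      | add g g' hg hg' ih ih' =>
        rw [spinInner_add_left (H_le_spinL2 hs hg) (H_le_spinL2 hs hg') hfh, ih, ih', add_zero]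
      | smul c g _ ih => rw [spinInner_smul_left, ih, mul_zero]
    · have hK : ∀ y, Kls l s R' R x y * f R y = ∑ m ∈ Finset.Icc (-(l : ℤ)) l,
          sY l s m R' x * (f R y * conj (sY l s m R y)) := fun y => by
        rw [Kls, Finset.sum_mul]
        exact Finset.sum_congr rfl fun m _ => by ring
      have hint : ∀ m ∈ Finset.Icc (-(l : ℤ)) l, Integrable (fun y =>
          sY l s m R' x * (f R y * conj (sY l s m R y))) dS := fun m hm =>
        (integrable_spinL2 hf (hY m hm) R).const_mul _
      simp only [hK]
      refine ⟨integrable_finsetSum _ hint, ?_⟩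
      rw [integral_finsetSum _ hint, hh, Finset.sum_apply, Finset.sum_apply]
      refine Finset.sum_congr rfl fun m hm => ?_
      rw [integral_const_mul, ← spinInner_eq_integral hf.1 (hY m hm).1 R]
      simp only [Pi.smul_apply, smul_eq_mul]
      ring

/-! ### The zonal harmonic -/

theorem spinCoeff_zonal {l : ℕ} {s : ℤ} (hs : s.natAbs ≤ l) :
    spinCoeff l s (l - s).toNat = (-1) ^ s.toNat * Real.sqrt ((2 * l + 1) / (4 * Real.pi)) := by
  have hi : (l - s).toNat ≤ 2 * l := by omega
  have h1 := spinCoeff_sq hs hi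
  rw [mul_div_cancel_right₀ _ (by exact_mod_cast (Nat.choose_pos hi).ne')] at h1
  rw [← h1]
  set x := Real.sqrt (zfact (l - s.natAbs) / zfact (l + s.natAbs)) *
    (aCoeff l (((l - s).toNat : ℤ) - l) / l.factorial) * l.descFactorial s.natAbs
  have hx : 0 ≤ x := by unfold x aCoeff; positivity
  have h2 : spinCoeff l s (l - s).toNat = (-1) ^ s.toNat * x := by
    -- For `s < 0` the natural subtraction truncates to `0`, so both signs of `s` yield `s⁺`.
    rw [spinCoeff, show l - (l - s).toNat = s.toNat by omega]
    ring
  rw [h2, mul_pow, ← pow_mul, mul_comm s.toNat, pow_mul, neg_one_sq, one_pow, one_mul,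
    Real.sqrt_sq hx]

theorem sZ_eq {l : ℕ} {s : ℤ} (hs : s.natAbs ≤ l) :
    sZ l s = (spinCoeff l s (l - s).toNat : ℂ) • sY l s (-s) := by
  rw [sZ, spinCoeff_zonal hs]

/-- The default azimuth `0` at the pole makes the default frame direction there exactly `∂/∂y`,
although the pole is outside the chart of the identity. -/
theorem ref_one_north : ref 1 north = ![0, 1, 0] := by
  have h : azimuth north = 0 := by simp [azimuth, north, Complex.arg]
  rw [ref, inv_one, rot_one, refI, h]
  simp

theorem spinPoly_north {l : ℕ} {s : ℤ} (hs : s.natAbs ≤ l) :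
    spinPoly l s 1 north = Polynomial.X ^ (l - s).toNat := by
  have h1 : nullPoly (cvec north) = Polynomial.X := by
    simp [nullPoly, cvec, north]
  have h2 : tang 1 north = ![1, Complex.I, 0] := by
    ext i
    simp only [tang, ref_one_north, cross_apply]
    fin_cases i <;> simp [north]
  rw [spinPoly, h1, spinVec, h2]
  split_ifs with h0
  · have : nullPoly (-![1, Complex.I, 0]) = 1 := by
      apply Polynomial.funext
      intro z
      simp [nullPoly]
      ring
    rw [this, one_pow, mul_one]
    congr 1
    omega
  · have : nullPoly (star ![1, Complex.I, 0]) = Polynomial.X ^ 2 := by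
      apply Polynomial.funext
      intro z
      simp [nullPoly]
    rw [this, ← pow_mul, ← pow_add]
    congr 1
    omega

theorem sZ_eq_Kls_north {l : ℕ} {s : ℤ} (hs : s.natAbs ≤ l) (R R' : SO3) {x : S2}
    (hN : north ∈ chart R) (hx : x ∈ chart 1 ∩ chart R') :
    sZ l s 1 x = Complex.exp (Complex.I * s *
      (angle x (ref R' x) (ref 1 x) - angle north (ref R north) ![0, 1, 0])) *
        Kls l s R' R x north := by
  have hm : -s ∈ Finset.Icc (-(l : ℤ)) l := Finset.mem_Icc.2 ⟨by omega, by omega⟩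
  have hcoeff : ∀ i : ℕ, (spinPoly l s R north).coeff i =
      Complex.exp (-(Complex.I * s * angle north (ref R north) ![0, 1, 0])) *
        if i = (l - s).toNat then 1 else 0 := fun i => by
    have h := spinPoly_transition l s R 1 north
    rw [spinPoly_north hs, ref_one_north] at h
    have h' := congrArg (fun P => Polynomial.coeff P i) h
    simp only [Polynomial.coeff_C_mul, Polynomial.coeff_X_pow] at h'
    rw [h', ← mul_assoc, ← Complex.exp_add, neg_add_cancel, Complex.exp_zero, one_mul]
  rw [Kls, Finset.sum_eq_single (-s), sZ_eq hs]
  · have e : -s = (((l - s).toNat : ℕ) : ℤ) - l := by omega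
    have h1 := sY_transition hs (Finset.mem_Icc.1 hm).1 (Finset.mem_Icc.1 hm).2 R' 1 x hx.symm
    have h2 : sY l s (-s) R north = spinCoeff l s (l - s).toNat *
        (spinPoly l s R north).coeff (l - s).toNat := by
      conv_lhs => rw [e]
      exact sY_eq_coeff hs R hN
    simp only [Pi.smul_apply, smul_eq_mul]
    rw [h1, h2, hcoeff, if_pos rfl, mul_one, map_mul, Complex.conj_ofReal, ← Complex.exp_conj,
      mul_sub, Complex.exp_sub]
    simp only [map_neg, map_mul, Complex.conj_I, Complex.conj_ofReal, map_intCast,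
      neg_mul, neg_neg]
    field_simp
  · intro m hm' hne
    obtain ⟨i, hi, rfl⟩ := exists_index (Finset.mem_Icc.1 hm').1 (Finset.mem_Icc.1 hm').2
    rw [sY_eq_coeff hs R hN, hcoeff, if_neg (by omega)]
    simp
  · exact fun h => absurd hm h

theorem spinInner_sZ {l : ℕ} {s : ℤ} (hs : s.natAbs ≤ l) {i : ℕ} (hi : i ≤ 2 * l) :
    spinInner (sY l s ((i : ℤ) - l)) (sZ l s) =
      if i = (l - s).toNat then (spinCoeff l s i : ℂ) else 0 := by
  rw [← spinInner_conj_symm, sZ_eq hs, spinInner_smul_left,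
    spinInner_sY hs (by omega) (by omega) (by omega) (by omega)]
  by_cases h : i = (l - s).toNat
  · rw [if_pos (by omega), if_pos h, ← h]
    simp
  · rw [if_neg (by omega), if_neg h]
    simp

/-! ### The limit at the north pole -/

theorem tendsto_coeff_wignerPoly (a b i : ℕ) :
    Tendsto (fun θ => (wignerPoly a b θ).coeff i) (𝓝[>] 0) (𝓝 (if i = a then 1 else 0)) := by
  have h0 : (wignerPoly a b 0).coeff i = if i = a then 1 else 0 := by
    simp [wignerPoly, Polynomial.coeff_X_pow]
  have hc : Continuous fun θ => (wignerPoly a b θ).coeff i := by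
    simp only [coeff_wignerPoly]
    refine continuous_finsetSum _ fun r _ => ?_
    split_ifs <;> fun_prop
  rw [← h0]
  exact (hc.tendsto 0).mono_left nhdsWithin_le_nhds

/-- The factor `⊤` in the product filter leaves `φ` unrestricted, which expresses uniformity in `φ`.
The variable `φ` enters only through the phase `e^{i(s + m)φ}`: it is trivial when `m = -s`, and
otherwise the modulus depends on `θ` alone and tends to `0`. -/
theorem tendsto_sY_north {l : ℕ} {s : ℤ} (hs : s.natAbs ≤ l) {i : ℕ} (hi : i ≤ 2 * l) :
    Tendsto (fun z : ℝ × ℝ => Complex.exp (Complex.I * s * z.2) *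
      sY l s ((i : ℤ) - l) 1 (sph z.1 z.2)) (𝓝[>] (0 : ℝ) ×ˢ (⊤ : Filter ℝ))
      (𝓝 (spinInner (sY l s ((i : ℤ) - l)) (sZ l s))) := by
  rw [spinInner_sZ hs hi]
  set a := (l - s).toNat
  set d : ℝ → ℝ := fun θ => (wignerPoly a (l + s).toNat θ).coeff i
  have hev : ∀ᶠ z : ℝ × ℝ in 𝓝[>] (0 : ℝ) ×ˢ (⊤ : Filter ℝ),
      Complex.exp (Complex.I * ((s + i - l : ℤ) : ℂ) * z.2) * ((spinCoeff l s i * d z.1 : ℝ) : ℂ) =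
      Complex.exp (Complex.I * s * z.2) * sY l s ((i : ℤ) - l) 1 (sph z.1 z.2) := by
    have h1 : ∀ᶠ θ : ℝ in 𝓝[>] (0 : ℝ), 0 < Real.sin θ := by
      filter_upwards [Ioo_mem_nhdsGT Real.pi_pos] with θ hθ
      exact Real.sin_pos_of_mem_Ioo hθ
    filter_upwards [tendsto_fst.eventually h1] with z hz
    rw [sY_eq_coeff hs 1 (mem_chart_one.2 (sph_mem_compl _ hz.ne')),
      coeff_spinPoly_sph hs z.2 hz, mul_left_comm (Complex.exp _) (spinCoeff l s i : ℂ),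
      ← mul_assoc (Complex.exp _) (Complex.exp _), ← Complex.exp_add]
    push_cast
    rw [show Complex.I * ((s : ℂ) + i - l) * z.2 =
      Complex.I * s * z.2 + Complex.I * ((i : ℂ) - l) * z.2 by ring]
    ring
  refine Tendsto.congr' hev ?_
  have hd : Tendsto (fun z : ℝ × ℝ => spinCoeff l s i * d z.1) (𝓝[>] (0 : ℝ) ×ˢ (⊤ : Filter ℝ))
      (𝓝 (spinCoeff l s i * if i = a then 1 else 0)) :=
    ((tendsto_coeff_wignerPoly a _ i).comp tendsto_fst).const_mul _
  by_cases h : i = a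
  · rw [if_pos h, mul_one] at hd
    rw [if_pos h, show s + i - l = 0 by omega]
    simp only [Int.cast_zero, mul_zero, zero_mul, Complex.exp_zero, one_mul]
    exact (Complex.continuous_ofReal.tendsto _).comp hd
  · rw [if_neg h, mul_zero] at hd
    rw [if_neg h]
    refine squeeze_zero_norm (fun z => ?_) (by simpa using hd.abs)
    rw [norm_mul, norm_exp_I_mul_mul, one_mul, Complex.norm_real, Real.norm_eq_abs, abs_mul]

theorem tendsto_north {l : ℕ} {s : ℤ} (hs : s.natAbs ≤ l) {f : Family} (hf : f ∈ H l s) :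
    Tendsto (fun z : ℝ × ℝ => Complex.exp (Complex.I * s * z.2) * f 1 (sph z.1 z.2))
      (𝓝[>] (0 : ℝ) ×ˢ (⊤ : Filter ℝ)) (𝓝 (spinInner f (sZ l s))) := by
  have hZ : sZ l s ∈ spinL2 s := by
    rw [sZ_eq hs]
    exact Submodule.smul_mem _ _ (sY_mem_spinL2 hs (by omega) (by omega))
  induction hf using Submodule.span_induction with
  | mem f hf =>
    obtain ⟨m, h1, h2, rfl⟩ := hf
    obtain ⟨i, hi, rfl⟩ := exists_index h1 h2
    exact tendsto_sY_north hs hi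
  | zero => simp [spinInner_zero_left]
  | add f g hf hg ihf ihg =>
    rw [spinInner_add_left (H_le_spinL2 hs hf) (H_le_spinL2 hs hg) hZ]
    simpa only [Pi.add_apply, mul_add] using ihf.add ihg
  | smul c f _ ih =>
    rw [spinInner_smul_left]
    simpa only [Pi.smul_apply, smul_eq_mul, mul_left_comm c] using ih.const_mul c

end SpinSphere

end

theorem theorem5p1 (l : ℕ) (s : ℤ) (hs : |s| ≤ (l : ℤ)) :
    SpinSphere.IsProjectionKernel s (SpinSphere.H l s) (SpinSphere.Kls l s) ∧
    (∀ (R R' : SpinSphere.SO3) (x : SpinSphere.S2),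
      SpinSphere.north ∈ SpinSphere.chart R →
      x ∈ SpinSphere.chart 1 ∩ SpinSphere.chart R' →
      SpinSphere.sZ l s 1 x =
        Complex.exp (Complex.I * s *
          (SpinSphere.angle x (SpinSphere.ref R' x) (SpinSphere.ref 1 x) -
            SpinSphere.angle SpinSphere.north (SpinSphere.ref R SpinSphere.north) ![0, 1, 0])) *
          SpinSphere.Kls l s R' R x SpinSphere.north) ∧
    (∀ f ∈ SpinSphere.H l s,
      Tendsto
        (fun z : ℝ × ℝ => Complex.exp (Complex.I * s * z.2) * f 1 (SpinSphere.sph z.1 z.2))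
        (𝓝[>] (0 : ℝ) ×ˢ (⊤ : Filter ℝ))
        (𝓝 (SpinSphere.spinInner f (SpinSphere.sZ l s)))) := by
  have hs' : s.natAbs ≤ l := by
    rw [Int.abs_eq_natAbs] at hs
    exact_mod_cast hs
  exact ⟨SpinSphere.isProjectionKernel_Kls hs',
    fun R R' _ hN hx => SpinSphere.sZ_eq_Kls_north hs' R R' hN hx,
    fun _ hf => SpinSphere.tendsto_north hs' hf⟩
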